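/- **Conventions.** Terms are built from function symbols of fixed arity and an infinite set of variables; substitutions have finite domain. Pairs of terms (equations, rewrite rules, critical pairs) are identified modulo renaming of variables. A rewrite rule $l\to r$ is a pair with $l$ not a variable and $\mathcal V(r)\subseteq\mathcal V(l)$; a TRS is a finite set of rewrite rules. $\to_{\mathcal R}$ is the rewrite relation of $\mathcal R$, $\leftrightarrow_{\mathcal R}$ its symmetric closure, and $s\Rightarrow^{\parallel}_{\mathcal R}t$ means that $t$ is obtained from $s$ by simultaneously contracting $\mathcal R$-redexes at a (possibly empty) set of pairwise parallel positions. $\mathcal R$ is confluent if ${\stackrel{*}{\gets}_{\mathcal R}}\circ{\stackrel{*}{\to}_{\mathcal R}}\subseteq{\stackrel{*}{\to}_{\mathcal R}}\circ{\stackrel{*}{\gets}_{\mathcal R}}$; it is reversible if $s\to_{\mathcal R}t$ implies $t\stackrel{*}{\to}_{\mathcal R}s$; it is left-linear if no variable occurs twice in a left-hand side; it is terminating if $\to_{\mathcal R}$ admits no infinite chain, and $\mathcal S$ is terminating relative to $\mathcal P$ if $\to_{\mathcal S}\circ\stackrel{*}{\to}_{\mathcal P}$ admits none. Write $\mathcal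 P^{\pm}=\mathcal P\cup\mathcal P^{-1}$. $\mathrm{CP}(\mathcal R,\mathcal Q)$ is the set of critical pairs $\langle l_2[r_1]_p\sigma,\,r_2\sigma\rangle$ with $l_1\to r_1\in\mathcal R$ and $l_2\to r_2\in\mathcal Q$ renamed apart, $l_2/p$ not a variable and $\sigma$ a most general unifier of $l_1$ and $l_2/p$ (excluding $p=\epsilon$ when the two rules are equal modulo renaming); $\mathrm{CP}_{in}(\mathcal R,\mathcal Q)$ consists of those with $p\neq\epsilon$. **The procedure** (nondeterministic; input a TRS $\mathcal R$; it may return Success or Failure, or diverge). 1. Put $\mathcal Q_0:=\mathcal R$, $i:=0$. 2. Take a partition $\mathcal Q_i=\mathcal S_i\uplus\mathcal P_i$ with $\mathcal S_i$ left-linear and terminating, $\mathcal P_i$ reversible and $\mathrm{CP}_{in}(\mathcal P_i^{\pm},\mathcal S_i)=\emptyset$, and go to 3; if there is none, return Failure. Instead of this, any number of times, one may take any partition $\mathcal Q_i=\mathcal S_i\uplus\mathcal P_i$ with $\mathcal P_i$ reversible and perform one of the following, then put $i:=i+1$ and stay in 2: - (2a) if $l\to r\in\mathcal S_i$, $r\leftrightarrow_{\mathcal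 P_i}r'$ and $\mathrm{CP}_{in}(\mathcal P_i^{\pm},\{l\to r\})\ne\emptyset$, put $\mathcal Q_{i+1}:=(\mathcal Q_i\setminus\{l\to r\})\cup\{l\to r'\}$; - (2b) if $\langle u,v\rangle\in\mathrm{CP}_{in}(\mathcal P_i^{\pm},\mathcal S_i)$ and $\hat v$ is an $\mathcal S_i$-normal form of $v$, put $\mathcal Q_{i+1}:=\mathcal Q_i\cup\{u\to\hat v\}$. 3. For each $\langle u,v\rangle\in\mathrm{CP}(\mathcal S_i,\mathcal P_i^{\pm})$ take $\mathcal S_i$-normal forms $\hat u,\hat v$ of $u,v$; if not $\hat u\Rightarrow^{\parallel}_{\mathcal P_i^{\pm}}\hat v$, put $\langle b,v\approx\hat u\rangle$ into $\mathcal U_1$ (initially empty), where $b$ is true if $v$ is $\mathcal S_i$-normal and false otherwise. 4. For each $\langle u,v\rangle\in\mathrm{CP}(\mathcal S_i,\mathcal S_i)$ take $\mathcal S_i$-normal forms $\hat u,\hat v$ of $u,v$; if not $\hat v\Rightarrow^{\parallel}_{\mathcal P_i^{\pm}}\hat u$, put $\langle\text{false},\hat u\approx\hat v\rangle$ into $\mathcal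 U_2$ (initially empty). If $\mathcal U_1=\mathcal U_2=\emptyset$, return Success. 5. For each $\langle b,u\approx v\rangle\in\mathcal U_1\cup\mathcal U_2$ check whether there are $u',v'$ with $v\stackrel{*}{\to}_{\mathcal S_i\cup\mathcal P_i^{\pm}}v'\Rightarrow^{\parallel}_{\mathcal P_i^{\pm}}u'$ and, if $b$ is true, $u=u'$, and, if $b$ is false, $u\to_{\mathcal S_i}\circ\stackrel{*}{\to}_{\mathcal S_i\cup\mathcal P_i^{\pm}}u'$. Let $\mathcal P'$ be the set of rules of $\mathcal P_i^{\pm}$ used in the sequences from $u$ to $u'$ and from $v$ to $v'$ that were found. If all checks succeed and $\mathcal S_i$ is terminating relative to $\mathcal P'$, return Success. Otherwise take a set of rewrite rules $\mathcal U'\subseteq\{v\to\hat u\mid\langle b,v\approx\hat u\rangle\in\mathcal U_1\}\cup\{l\to r,\,r\to l\mid\langle b,l\approx r\rangle\in\mathcal U_2,\ l\stackrel{*}{\leftrightarrow}_{\mathcal P_i}r\}$, put $\mathcal Q_{i+1}:=\mathcal Q_i\cup\mathcal U'$, $i:=i+1$, and go to 2. Before going to 2, one may once perform - (4a) with $\mathcal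 S_i:=\mathcal S_{i-1}$, $\mathcal P_i:=\mathcal P_{i-1}$: if $l\to r\in\mathcal S_i$, $r\leftrightarrow_{\mathcal P_i}r'$, and some pair in $\mathrm{CP}(\{l\to r\},\mathcal P_i^{\pm})$ has failed the test of 3, or some pair in $\mathrm{CP}(\{l\to r\},\mathcal S_i)\cup\mathrm{CP}(\mathcal S_i,\{l\to r\})$ has failed the test of 4, put $\mathcal Q_{i+1}:=(\mathcal Q_i\setminus\{l\to r\})\cup\{l\to r'\}$ and $i:=i+1$. In the *amended* version of the procedure the check in 5 of an equation $u\approx v$ of $\mathcal U_2$ also succeeds if $u\stackrel{*}{\to}_{\mathcal S_i\cup\mathcal P_i^{\pm}}u'$ takes the place of $u\to_{\mathcal S_i}\circ\stackrel{*}{\to}_{\mathcal S_i\cup\mathcal P_i^{\pm}}u'$. **Corollary 4.7** (soundness of the concrete reduction-preserving completion procedure). If some run of the procedure, in the literal or in the amended version, returns Success on the input TRS $\mathcal R$, then $\mathcal R$ is confluent. -/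

import Mathlib

/-!
First-order term rewriting over an arbitrary signature and the concrete reduction-preserving
completion procedure, given as a nondeterministic transition system.

Terms are `L.Term V`, with `L.Functions n` the function symbols of arity `n` (the relation symbols
of `L` play no role) and `V` the set of variables.
-/

namespace Rewriting

open FirstOrder FirstOrder.Language

universe u v w

section Terms

variable {L : FirstOrder.Language.{u, v}} {V : Type w}

/-- The set of variables occurring in a term. -/
noncomputable def vars (t : L.Term V) : Set V :=
  letI := Classical.decEq V
  ↑t.varFinset

/-- The term is a variable. -/
def IsVar (t : L.Term V) : Prop := ∃ x, t = Term.var x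

/-- Linear terms: every variable occurs at most once. -/
def Linear : L.Term V → Prop
  | .var _ => True
  | .func _ ts => (∀ i, Linear (ts i)) ∧ ∀ i j, i ≠ j → Disjoint (vars (ts i)) (vars (ts j))

/-- Substitutions: maps from variables to terms with finite domain. -/
structure Subst (L : FirstOrder.Language.{u, v}) (V : Type w) where
  toFun : V → L.Term V
  finite_dom : {x | toFun x ≠ Term.var x}.Finite

/-- The homomorphic extension `tσ` of a substitution. -/
def Subst.app (σ : Subst L V) (t : L.Term V) : L.Term V := t.subst σ.toFun

/-- `ReplaceAt p s a b t`: `p` is a position of `s`, the subterm of `s` at `p` is `a`, and `t` is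
the result of replacing it by `b`. -/
inductive ReplaceAt : List ℕ → L.Term V → L.Term V → L.Term V → L.Term V → Prop
  | here (a b : L.Term V) : ReplaceAt [] a a b b
  | arg {n : ℕ} (f : L.Functions n) (ts : Fin n → L.Term V) (i : Fin n) (p : List ℕ)
      (a b t : L.Term V) (h : ReplaceAt p (ts i) a b t) :
      ReplaceAt ((i : ℕ) :: p) (Term.func f ts) a b (Term.func f (Function.update ts i t))

/-- `σ` is a most general unifier of `s` and `t`. -/
def IsMGU (σ : Subst L V) (s t : L.Term V) : Prop :=
  σ.app s = σ.app t ∧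
    ∀ τ : Subst L V, τ.app s = τ.app t → ∃ δ : Subst L V, ∀ x, τ.toFun x = δ.app (σ.toFun x)

end Terms

section Equations

/-- Ordered pairs of terms, identified modulo renaming of variables. -/
def variantSetoid (L : FirstOrder.Language.{u, v}) (V : Type w) : Setoid (L.Term V × L.Term V) where
  r a b := ∃ π : Equiv.Perm V, a.1.relabel π = b.1 ∧ a.2.relabel π = b.2
  iseqv :=
    { refl := fun a => ⟨Equiv.refl V, by simp [Equiv.coe_refl]⟩
      symm := by
        rintro a b ⟨π, h1, h2⟩
        refine ⟨π.symm, ?_, ?_⟩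
        · rw [← h1]; simp
        · rw [← h2]; simp
      trans := by
        rintro a b c ⟨π, h1, h2⟩ ⟨ρ, h3, h4⟩
        refine ⟨π.trans ρ, ?_, ?_⟩
        · rw [← h3, ← h1, Term.relabel_relabel]; rfl
        · rw [← h4, ← h2, Term.relabel_relabel]; rfl }

/-- Equations (and rewrite rules, and critical pairs): pairs of terms modulo renaming. -/
def Eqn (L : FirstOrder.Language.{u, v}) (V : Type w) : Type (max u w) :=
  Quotient (variantSetoid L V)

variable {L : FirstOrder.Language.{u, v}} {V : Type w}

/-- The equation `l ≈ r` (or rule `l → r`, or pair `⟨l, r⟩`), modulo renaming. -/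
def eqn (l r : L.Term V) : Eqn L V := Quotient.mk (variantSetoid L V) (l, r)

/-- `l ≈ r` is a rewrite rule: `l` is not a variable and every variable of `r` occurs in `l`. -/
def IsRule (e : Eqn L V) : Prop := ∃ l r, e = eqn l r ∧ ¬ IsVar l ∧ vars r ⊆ vars l

/-- Term rewriting systems: finite sets of rewrite rules. -/
def IsTRS (R : Set (Eqn L V)) : Prop := R.Finite ∧ ∀ e ∈ R, IsRule e

def LeftLinear (R : Set (Eqn L V)) : Prop := ∀ l r, eqn l r ∈ R → Linear l

/-- `R⁻¹`. -/
def inverse (R : Set (Eqn L V)) : Set (Eqn L V) := {e | ∃ l r, e = eqn r l ∧ eqn l r ∈ R}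

/-- `R ∪ R⁻¹`. -/
def symm (R : Set (Eqn L V)) : Set (Eqn L V) := R ∪ inverse R

/-- A rewrite step that uses the rule `e`. -/
def StepBy (e : Eqn L V) (s t : L.Term V) : Prop :=
  ∃ (p : List ℕ) (l r : L.Term V) (θ : Subst L V),
    e = eqn l r ∧ ReplaceAt p s (θ.app l) (θ.app r) t

/-- The rewrite relation `→_R`. -/
def Step (R : Set (Eqn L V)) (s t : L.Term V) : Prop := ∃ e ∈ R, StepBy e s t

/-- `→*_R`. -/
def Steps (R : Set (Eqn L V)) : L.Term V → L.Term V → Prop := Relation.ReflTransGen (Step R)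

/-- `↔_R`. -/
def Conv (R : Set (Eqn L V)) (s t : L.Term V) : Prop := Step R s t ∨ Step R t s

/-- `↔*_R`. -/
def Convs (R : Set (Eqn L V)) : L.Term V → L.Term V → Prop := Relation.ReflTransGen (Conv R)

/-- The parallel extension of `→_R`: redexes at pairwise parallel positions (possibly none) are
contracted simultaneously. -/
inductive Par (R : Set (Eqn L V)) : L.Term V → L.Term V → Prop
  | var (x : V) : Par R (Term.var x) (Term.var x)
  | root (l r : L.Term V) (θ : Subst L V) (h : eqn l r ∈ R) : Par R (θ.app l) (θ.app r)
  | func {n : ℕ} (f : L.Functions n) (ts us : Fin n → L.Term V) (h : ∀ i, Par R (ts i) (us i)) :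
      Par R (Term.func f ts) (Term.func f us)

/-- `RewSeq R s t A`: there is a rewrite sequence `s →*_R t` in which `A` is exactly the set of
rules used. -/
inductive RewSeq (R : Set (Eqn L V)) (s : L.Term V) : L.Term V → Set (Eqn L V) → Prop
  | refl : RewSeq R s s ∅
  | tail {t t' : L.Term V} {A : Set (Eqn L V)} {e : Eqn L V} (h : RewSeq R s t A) (he : e ∈ R)
      (hs : StepBy e t t') : RewSeq R s t' (insert e A)

def Normal (R : Set (Eqn L V)) (s : L.Term V) : Prop := ∀ t, ¬ Step R s t

/-- `t` is an `R`-normal form of `s`. -/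
def IsNormalFormOf (R : Set (Eqn L V)) (t s : L.Term V) : Prop := Steps R s t ∧ Normal R t

def Confluent (R : Set (Eqn L V)) : Prop :=
  ∀ s t t', Steps R s t → Steps R s t' → ∃ w, Steps R t w ∧ Steps R t' w

/-- `→_R` has no infinite descending chain. -/
def Terminating (R : Set (Eqn L V)) : Prop := WellFounded fun t s : L.Term V => Step R s t

/-- `S` is terminating relative to `P`: `→_S ∘ →*_P` has no infinite descending chain. -/
def RelTerminating (S P : Set (Eqn L V)) : Prop :=
  WellFounded fun t s : L.Term V => ∃ w, Step S s w ∧ Steps P w t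

def Reversible (R : Set (Eqn L V)) : Prop := ∀ s t, Step R s t → Steps R t s

/-- `⟨a, b⟩` is a critical pair obtained by an overlap of (a variant of) the rule `e₁` on
(a variant of) the rule `e₂` at the position `p`; in a self-overlap the root is excluded. -/
def IsCriticalPair (p : List ℕ) (e₁ e₂ : Eqn L V) (a b : L.Term V) : Prop :=
  ∃ (l₁ r₁ l₂ r₂ s w : L.Term V) (σ : Subst L V),
    e₁ = eqn l₁ r₁ ∧ e₂ = eqn l₂ r₂ ∧
    Disjoint (vars l₁ ∪ vars r₁) (vars l₂ ∪ vars r₂) ∧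
    ReplaceAt p l₂ s r₁ w ∧ ¬ IsVar s ∧ IsMGU σ l₁ s ∧
    ¬ (e₁ = e₂ ∧ p = []) ∧
    a = σ.app w ∧ b = σ.app r₂

/-- Outer critical pairs of overlaps of a rule of `R` on a rule of `Q`. -/
def CPout (R Q : Set (Eqn L V)) : Set (Eqn L V) :=
  {c | ∃ e₁ ∈ R, ∃ e₂ ∈ Q, ∃ a b, IsCriticalPair [] e₁ e₂ a b ∧ c = eqn a b}

/-- Inner critical pairs of overlaps of a rule of `R` on a rule of `Q`. -/
def CPin (R Q : Set (Eqn L V)) : Set (Eqn L V) :=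
  {c | ∃ e₁ ∈ R, ∃ e₂ ∈ Q, ∃ p a b, p ≠ [] ∧ IsCriticalPair p e₁ e₂ a b ∧ c = eqn a b}

def CP (R Q : Set (Eqn L V)) : Set (Eqn L V) := CPout R Q ∪ CPin R Q

end Equations

section Procedure

/-- A pair `⟨a, b⟩` together with chosen reducts of `a` and `b`. -/
structure NormPair (L : FirstOrder.Language.{u, v}) (V : Type w) where
  a : L.Term V
  b : L.Term V
  aNF : L.Term V
  bNF : L.Term V

variable {L : FirstOrder.Language.{u, v}} {V : Type w}

/-- `N` takes, for each pair `⟨a, b⟩` of `C`, an `S`-normal form of `a` and one of `b`. -/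
def TakesNormalForms (S C : Set (Eqn L V)) (N : Eqn L V → NormPair L V) : Prop :=
  ∀ c ∈ C, c = eqn (N c).a (N c).b ∧
    IsNormalFormOf S (N c).aNF (N c).a ∧ IsNormalFormOf S (N c).bNF (N c).b

/-- The check of Step 3 fails for the critical pair `c`. -/
def Fails₁ (P : Set (Eqn L V)) (N : Eqn L V → NormPair L V) (c : Eqn L V) : Prop :=
  ¬ Par (symm P) (N c).aNF (N c).bNF

/-- The check of Step 4 fails for the critical pair `c`. -/
def Fails₂ (P : Set (Eqn L V)) (N : Eqn L V → NormPair L V) (c : Eqn L V) : Prop :=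
  ¬ Par (symm P) (N c).bNF (N c).aNF

/-- The set `U₁` computed in Step 3 from the chosen normal forms. -/
def U₁ (S P : Set (Eqn L V)) (N : Eqn L V → NormPair L V) : Set (Bool × Eqn L V) :=
  {x | ∃ c ∈ CP S (symm P), Fails₁ P N c ∧
    (x.1 = true ↔ Normal S (N c).b) ∧ x.2 = eqn (N c).b (N c).aNF}

/-- The set `U₂` computed in Step 4 from the chosen normal forms. -/
def U₂ (S P : Set (Eqn L V)) (N : Eqn L V → NormPair L V) : Set (Bool × Eqn L V) :=
  {x | ∃ c ∈ CP S S, Fails₂ P N c ∧ x = (false, eqn (N c).aNF (N c).bNF)}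

/-- The check of Step 5 for the tagged equation `⟨b, s ≈ t⟩`: the sequences exist, and `A` is the
set of rules they use. -/
def Check (S P : Set (Eqn L V)) : Bool → L.Term V → L.Term V → Set (Eqn L V) → Prop
  | true, s, t, A => ∃ t', RewSeq (S ∪ symm P) t t' A ∧ Par (symm P) t' s
  | false, s, t, A => ∃ (e : Eqn L V) (w s' t' : L.Term V) (A₁ A₂ : Set (Eqn L V)),
      e ∈ S ∧ StepBy e s w ∧ RewSeq (S ∪ symm P) w s' A₁ ∧ RewSeq (S ∪ symm P) t t' A₂ ∧
      Par (symm P) t' s' ∧ A = insert e (A₁ ∪ A₂)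

/-- The check of `Check` with tag `false`, without the demand that the sequence from `s` starts
with an `S`-step. -/
def JoinCheck (S P : Set (Eqn L V)) (s t : L.Term V) (A : Set (Eqn L V)) : Prop :=
  ∃ (s' t' : L.Term V) (A₁ A₂ : Set (Eqn L V)),
    RewSeq (S ∪ symm P) s s' A₁ ∧ RewSeq (S ∪ symm P) t t' A₂ ∧
    Par (symm P) t' s' ∧ A = A₁ ∪ A₂

/-- All checks of Step 5 succeed, and the rules of `P ∪ P⁻¹` used in the sequences that were found
form the set `P'`. In the literal version (`amended = false`) an equation `⟨b, s ≈ t⟩` of `U₂` is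
checked according to its tag `b`, exactly as the equations of `U₁`; in the amended version
(`amended = true`) the sequences for the equations of `U₂` need not start with an `S`-step. -/
def Gathers (amended : Bool) (S P : Set (Eqn L V)) (X₁ X₂ : Set (Bool × Eqn L V))
    (P' : Set (Eqn L V)) : Prop :=
  ∃ W₁ W₂ : Bool × Eqn L V → Set (Eqn L V),
    (∀ x ∈ X₁, ∃ s t, x.2 = eqn s t ∧ Check S P x.1 s t (W₁ x)) ∧
    (∀ x ∈ X₂, ∃ s t, x.2 = eqn s t ∧
      (Check S P x.1 s t (W₂ x) ∨ (amended = true ∧ JoinCheck S P s t (W₂ x)))) ∧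
    P' = {e ∈ symm P | (∃ x ∈ X₁, e ∈ W₁ x) ∨ ∃ x ∈ X₂, e ∈ W₂ x}

/-- The rules that may be added at the end of Step 5. -/
def Candidates (P : Set (Eqn L V)) (X₁ X₂ : Set (Bool × Eqn L V)) : Set (Eqn L V) :=
  {e | ∃ b, (b, e) ∈ X₁} ∪
    {e | ∃ b l r, (b, eqn l r) ∈ X₂ ∧ Convs P l r ∧ (e = eqn l r ∨ e = eqn r l)}

/-- `S ∪ P = Q` is a partition of `Q` with `P` reversible. -/
def IsPartition (Q S P : Set (Eqn L V)) : Prop := S ∪ P = Q ∧ Disjoint S P ∧ Reversible P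

/-- The partitions that Step 2 looks for. -/
def Admissible (Q S P : Set (Eqn L V)) : Prop :=
  IsPartition Q S P ∧ LeftLinear S ∧ Terminating S ∧ CPin (symm P) S = ∅

/-- Control states; `Q`, `S`, `P` hold the current `Qᵢ`, `Sᵢ`, `Pᵢ`, and `N₁`, `N₂` the normal forms
taken in Steps 3 and 4. In `step4a` the system `Q` has been extended at the end of Step 5 already,
whereas `S` and `P` are still those of the preceding round. -/
inductive State (L : FirstOrder.Language.{u, v}) (V : Type w)
  | step1 (R : Set (Eqn L V))
  | step2 (Q : Set (Eqn L V))
  | step3 (Q S P : Set (Eqn L V))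
  | step4 (Q S P : Set (Eqn L V)) (N₁ : Eqn L V → NormPair L V)
  | step5 (Q S P : Set (Eqn L V)) (N₁ N₂ : Eqn L V → NormPair L V)
  | step4a (Q S P : Set (Eqn L V)) (N₁ N₂ : Eqn L V → NormPair L V)
  | success
  | failure

/-- One transition of the concrete reduction-preserving completion procedure. -/
inductive Next (amended : Bool) : State L V → State L V → Prop
  | init (R : Set (Eqn L V)) : Next amended (.step1 R) (.step2 R)
  | partition (Q S P : Set (Eqn L V)) (h : Admissible Q S P) :
      Next amended (.step2 Q) (.step3 Q S P)
  | noPartition (Q : Set (Eqn L V)) (h : ∀ S P, ¬ Admissible Q S P) :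
      Next amended (.step2 Q) .failure
  /-- Step 2a -/
  | replaceInner (Q S P : Set (Eqn L V)) (l r r' : L.Term V) (hp : IsPartition Q S P)
      (hl : eqn l r ∈ S) (hr : Conv P r r') (hcp : (CPin (symm P) {eqn l r}).Nonempty) :
      Next amended (.step2 Q) (.step2 ((Q \ {eqn l r}) ∪ {eqn l r'}))
  /-- Step 2b -/
  | addInner (Q S P : Set (Eqn L V)) (a b b' : L.Term V) (hp : IsPartition Q S P)
      (hcp : eqn a b ∈ CPin (symm P) S) (hb : IsNormalFormOf S b' b) :
      Next amended (.step2 Q) (.step2 (Q ∪ {eqn a b'}))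
  | normalize₁ (Q S P : Set (Eqn L V)) (N₁ : Eqn L V → NormPair L V)
      (hN : TakesNormalForms S (CP S (symm P)) N₁) :
      Next amended (.step3 Q S P) (.step4 Q S P N₁)
  | success₄ (Q S P : Set (Eqn L V)) (N₁ N₂ : Eqn L V → NormPair L V)
      (hN : TakesNormalForms S (CP S S) N₂) (h₁ : U₁ S P N₁ = ∅) (h₂ : U₂ S P N₂ = ∅) :
      Next amended (.step4 Q S P N₁) .success
  | normalize₂ (Q S P : Set (Eqn L V)) (N₁ N₂ : Eqn L V → NormPair L V)
      (hN : TakesNormalForms S (CP S S) N₂) (h : ¬ (U₁ S P N₁ = ∅ ∧ U₂ S P N₂ = ∅)) :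
      Next amended (.step4 Q S P N₁) (.step5 Q S P N₁ N₂)
  | success₅ (Q S P P' : Set (Eqn L V)) (N₁ N₂ : Eqn L V → NormPair L V)
      (hP' : Gathers amended S P (U₁ S P N₁) (U₂ S P N₂) P') (ht : RelTerminating S P') :
      Next amended (.step5 Q S P N₁ N₂) .success
  /-- Some check of Step 5 fails, or the relative termination does; rules are added. -/
  | extend (Q S P U' : Set (Eqn L V)) (N₁ N₂ : Eqn L V → NormPair L V)
      (h : (∀ P', ¬ Gathers amended S P (U₁ S P N₁) (U₂ S P N₂) P') ∨
        ∃ P', Gathers amended S P (U₁ S P N₁) (U₂ S P N₂) P' ∧ ¬ RelTerminating S P')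
      (hU : U' ⊆ Candidates P (U₁ S P N₁) (U₂ S P N₂)) (hrule : ∀ e ∈ U', IsRule e) :
      Next amended (.step5 Q S P N₁ N₂) (.step4a (Q ∪ U') S P N₁ N₂)
  /-- Step 4a is skipped. -/
  | skip (Q S P : Set (Eqn L V)) (N₁ N₂ : Eqn L V → NormPair L V) :
      Next amended (.step4a Q S P N₁ N₂) (.step2 Q)
  /-- Step 4a: replacement of a rule one of whose critical pairs fails its check. -/
  | replaceBad (Q S P : Set (Eqn L V)) (N₁ N₂ : Eqn L V → NormPair L V) (l r r' : L.Term V)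
      (hl : eqn l r ∈ S) (hr : Conv P r r')
      (hc : (∃ c ∈ CP {eqn l r} (symm P), Fails₁ P N₁ c) ∨
        ∃ c ∈ CP {eqn l r} S ∪ CP S {eqn l r}, Fails₂ P N₂ c) :
      Next amended (.step4a Q S P N₁ N₂) (.step2 ((Q \ {eqn l r}) ∪ {eqn l r'}))

/-- Some run of the procedure on the input `R` returns `Success`. -/
def ReturnsSuccess (amended : Bool) (R : Set (Eqn L V)) : Prop :=
  Relation.ReflTransGen (Next amended) (State.step1 R) State.success

end Procedure

end Rewriting

namespace Rewriting

open FirstOrder FirstOrder.Language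

universe u v w

/-! ### Substitutions and renaming apart -/

section Substitutions

variable {L : FirstOrder.Language.{u, v}} {V : Type w}

/-! The argument has two halves: an invariant of the runs, and a confluence criterion modulo `P`
that applies when a run succeeds.

Invariant: every system met in a run has the same many-step rewrite relation as the input. An added
rule is derivable from the current system (a critical pair comes from a peak, and its `P`-half can
be reversed), and changing a right-hand side by a `P`-step is undone by `P`, which stays in the
system (`SameSteps.union`, `SameSteps.replace`). So confluence of the final `Q = S ∪ P` suffices.

Criterion (`confluent_of_peaks`): let `P'` be the set of rules of `P^±` used in the checks and put
`T = S ∪ P'`. Termination of `S` relative to `P'` makes an `S`-step followed by any `T`-steps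
well-founded. By the critical pair analysis, a peak of two `S`-steps is closed by `T`-reductions and
one parallel `P^±`-step (`peak_parJoinable`). A peak of an `S`-step and a parallel `P^±`-step is
closed likewise, and here the `T`-reduction on the `P`-side is empty or begins with an `S`-step
(`par_peak_headParJoinable`). This uses that `S` is left-linear and that `P^±` has no inner overlap
on `S`: a parallel step below an `S`-redex then acts only in the substitution.

Call an `S`-normal form of `s` a head normal form if it is reached by a `T`-reduction that is empty
or begins with an `S`-step. Well-founded induction shows that terms related by a parallel `P^±`-step
have head normal forms so related, and then that head normal forms are unique up to
`P^±`-conversion. Both facts extend along reductions of `S ∪ P^±`, and reversibility of `P` turns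
conversions into reductions. -/

@[simp] theorem vars_var (x : V) : vars (Term.var x : L.Term V) = {x} := by
  simp [vars]

@[simp] theorem vars_func {n : ℕ} (f : L.Functions n) (ts : Fin n → L.Term V) :
    vars (Term.func f ts) = ⋃ i, vars (ts i) := by
  simp [vars]

theorem vars_finite (t : L.Term V) : (vars t).Finite := Finset.finite_toSet _

theorem subst_subst (t : L.Term V) (g h : V → L.Term V) :
    (t.subst g).subst h = t.subst fun x => (g x).subst h := by
  induction t with
  | var x => rfl
  | func f ts ih => simp only [Term.subst, ih]

theorem subst_var (t : L.Term V) : t.subst Term.var = t := by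
  induction t with
  | var x => rfl
  | func f ts ih => simp only [Term.subst, ih]

theorem subst_congr {t : L.Term V} {g h : V → L.Term V} (H : ∀ x ∈ vars t, g x = h x) :
    t.subst g = t.subst h := by
  induction t with
  | var x => exact H x (by simp)
  | func f ts ih =>
    simp only [Term.subst]
    congr 1
    funext i
    exact ih i fun x hx => H x (by simpa using ⟨i, hx⟩)

theorem eqOn_vars_of_subst_eq {t : L.Term V} {g h : V → L.Term V} (H : t.subst g = t.subst h) :
    ∀ x ∈ vars t, g x = h x := by
  induction t with
  | var x => simpa using H
  | func f ts ih =>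
    simp only [Term.subst, Term.func.injEq, heq_eq_eq, true_and] at H
    intro x hx
    simp only [vars_func, Set.mem_iUnion] at hx
    obtain ⟨i, hi⟩ := hx
    exact ih i (congrFun H i) x hi

theorem relabel_eq_subst (t : L.Term V) (π : V → V) :
    t.relabel π = t.subst fun x => Term.var (π x) := by
  induction t with
  | var x => rfl
  | func f ts ih => simp only [Term.relabel, Term.subst, ih]

theorem vars_relabel (t : L.Term V) (π : V → V) : vars (t.relabel π) = π '' vars t := by
  induction t with
  | var x => simp [Term.relabel]
  | func f ts ih => simp only [Term.relabel, vars_func, ih, Set.image_iUnion]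

/-- Bridges the finite-domain substitutions of the definitions and the arbitrary maps used in the
proofs: only finitely many variables matter at a time. -/
theorem exists_subst_eqOn {F : Set V} (hF : F.Finite) (g : V → L.Term V) :
    ∃ θ : Subst L V, ∀ x ∈ F, θ.toFun x = g x := by
  classical
  refine ⟨⟨fun x => if x ∈ F then g x else Term.var x, hF.subset fun x hx => ?_⟩, fun x hx => ?_⟩
  · by_contra h
    simp [h] at hx
  · simp [hx]

theorem eqn_eq_iff {l r l' r' : L.Term V} :
    eqn l r = eqn l' r' ↔ ∃ π : Equiv.Perm V, l.relabel π = l' ∧ r.relabel π = r' :=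
  Quotient.eq (r := variantSetoid L V)

theorem exists_eqn (e : Eqn L V) : ∃ l r, e = eqn l r := by
  induction e using Quotient.inductionOn with
  | _ a => exact ⟨a.1, a.2, rfl⟩

theorem eqn_relabel (l r : L.Term V) (π : Equiv.Perm V) :
    eqn (l.relabel π) (r.relabel π) = eqn l r :=
  (eqn_eq_iff.2 ⟨π, rfl, rfl⟩).symm

/-- Instances of a term pair are instances of each of its variants. -/
theorem instance_of_eqn_eq {l r l' r' : L.Term V} (h : eqn l r = eqn l' r') (g : V → L.Term V) :
    ∃ g' : V → L.Term V, l.subst g = l'.subst g' ∧ r.subst g = r'.subst g' := by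
  obtain ⟨π, rfl, rfl⟩ := eqn_eq_iff.1 h
  refine ⟨fun x => g (π.symm x), ?_, ?_⟩ <;> simp [relabel_eq_subst, subst_subst, Term.subst]

/-- The permutations of an infinite set act `n`-transitively for every finite `n`, so some
permutation carries `A` onto a set of the same size outside `F`. -/
theorem exists_perm_disjoint [Infinite V] {A F : Set V} (hA : A.Finite) (hF : F.Finite) :
    ∃ π : Equiv.Perm V, Disjoint (π '' A) F := by
  classical
  obtain ⟨B, hBF, hB⟩ := hF.infinite_compl.exists_subset_card_eq hA.toFinset.card
  let a := hA.toFinset.equivFin.symm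
  let b := (B.equivFinOfCardEq hB).symm
  have := Equiv.Perm.isMultiplyPretransitive V hA.toFinset.card
  obtain ⟨π, hπ⟩ := MulAction.IsPretransitive.exists_smul_eq (M := Equiv.Perm V)
    (a.toEmbedding.trans (Function.Embedding.subtype _))
    (b.toEmbedding.trans (Function.Embedding.subtype _))
  refine ⟨π, Set.disjoint_left.2 ?_⟩
  rintro _ ⟨x, hx, rfl⟩
  have h := DFunLike.congr_fun hπ (a.symm ⟨x, hA.mem_toFinset.2 hx⟩)
  have h' : π x = (b (a.symm ⟨x, hA.mem_toFinset.2 hx⟩) : V) := by simpa using h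
  rw [h']
  exact hBF (b _).2

theorem exists_variant_disjoint [Infinite V] {F : Set V} (hF : F.Finite) (e : Eqn L V) :
    ∃ l r, e = eqn l r ∧ Disjoint (vars l ∪ vars r) F := by
  obtain ⟨l, r, rfl⟩ := exists_eqn e
  obtain ⟨π, hπ⟩ := exists_perm_disjoint ((vars_finite l).union (vars_finite r)) hF
  refine ⟨l.relabel π, r.relabel π, (eqn_relabel l r π).symm, ?_⟩
  rwa [vars_relabel, vars_relabel, ← Set.image_union]

end Substitutions

/-! ### Existence of most general unifiers -/

section Unification

variable {L : FirstOrder.Language.{u, v}} {V : Type w}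

/-- The number of symbols of a term. -/
def size : L.Term V → ℕ
  | .var _ => 1
  | .func _ ts => 1 + ∑ i, size (ts i)

theorem size_pos (t : L.Term V) : 0 < size t := by
  cases t <;> simp [size]

theorem size_le_size_subst {t : L.Term V} {x : V} (hx : x ∈ vars t) (g : V → L.Term V) :
    size (g x) ≤ size (t.subst g) := by
  induction t with
  | var y =>
    obtain rfl : x = y := by simpa using hx
    exact le_rfl
  | func f ts ih =>
    simp only [vars_func, Set.mem_iUnion] at hx
    obtain ⟨i, hi⟩ := hx
    have h : size ((ts i).subst g) ≤ ∑ i, size ((ts i).subst g) :=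
      Finset.single_le_sum (f := fun i => size ((ts i).subst g)) (fun _ _ => Nat.zero_le _)
        (Finset.mem_univ i)
    simp only [Term.subst, size]
    have := ih i hi
    omega

/-- The occurs check: `x` and a term `t ≠ x` that contains `x` cannot have a common instance. -/
theorem size_lt_size_subst {t : L.Term V} {x : V} (hx : x ∈ vars t) (ht : t ≠ Term.var x)
    (g : V → L.Term V) : size (g x) < size (t.subst g) := by
  cases t with
  | var y =>
    obtain rfl : x = y := by simpa using hx
    exact absurd rfl ht
  | func f ts =>
    simp only [vars_func, Set.mem_iUnion] at hx
    obtain ⟨i, hi⟩ := hx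
    have h : size ((ts i).subst g) ≤ ∑ i, size ((ts i).subst g) :=
      Finset.single_le_sum (f := fun i => size ((ts i).subst g)) (fun _ _ => Nat.zero_le _)
        (Finset.mem_univ i)
    simp only [Term.subst, size]
    have := size_le_size_subst hi g
    omega

/-- `g` solves all the equations of `E`. -/
def Unifies (g : V → L.Term V) (E : List (L.Term V × L.Term V)) : Prop :=
  ∀ e ∈ E, e.1.subst g = e.2.subst g

/-- `σ` solves `E`, and all solutions of `E` absorb `σ`. -/
def IsIdempotentMGU (σ : V → L.Term V) (E : List (L.Term V × L.Term V)) : Prop :=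
  Unifies σ E ∧ ∀ τ, Unifies τ E → ∀ x, (σ x).subst τ = τ x

theorem subst_update_absorb [DecidableEq V] {τ : V → L.Term V} {x : V} {t : L.Term V}
    (h : τ x = t.subst τ) (s : L.Term V) :
    (s.subst (Function.update Term.var x t)).subst τ = s.subst τ := by
  rw [subst_subst]
  refine subst_congr fun y _ => ?_
  by_cases hy : y = x
  · subst hy; simp [h]
  · simp [hy, Term.subst]

/-- Variable elimination: trivial equations are dropped; otherwise `x` does not occur in `t`, and
`x` is replaced by `t` throughout `E`. Since `g` solves `x ≈ t`, this leaves the `g`-instances, and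
hence their sizes, unchanged. The recursive call is passed in as `ih`, so that both orientations of
the equation can use the lemma. -/
theorem exists_mgu_cons_var {E : List (L.Term V × L.Term V)} {g : V → L.Term V} {x : V}
    {t : L.Term V} (hg : Unifies g E) (hx : g x = t.subst g)
    (ih : ∀ E' : List (L.Term V × L.Term V), Unifies g E' →
      (E'.map fun e => size (e.1.subst g)).sum ≤ (E.map fun e => size (e.1.subst g)).sum →
      ∃ σ, IsIdempotentMGU σ E') :
    ∃ σ, IsIdempotentMGU σ ((Term.var x, t) :: E) := by
  classical
  by_cases ht : t = Term.var x
  · obtain ⟨σ, hσ, hσ'⟩ := ih E hg le_rfl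
    refine ⟨σ, ?_, fun τ hτ => hσ' τ fun e he => hτ e (List.mem_cons_of_mem _ he)⟩
    intro e he
    rcases List.mem_cons.1 he with rfl | he
    · rw [ht]
    · exact hσ e he
  have hxt : x ∉ vars t := fun h => by
    have := size_lt_size_subst h ht g
    rw [hx] at this
    exact lt_irrefl _ this
  set ρ : V → L.Term V := Function.update Term.var x t with hρ
  obtain ⟨σ, hσ, hσ'⟩ := ih (E.map fun e => (e.1.subst ρ, e.2.subst ρ))
    (by
      intro e he
      obtain ⟨e', he', rfl⟩ := List.mem_map.1 he
      simpa only [hρ, subst_update_absorb hx] using hg e' he')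
    (by
      rw [List.map_map]
      refine le_of_eq (congrArg List.sum (List.map_congr_left fun e _ => ?_))
      simp only [Function.comp, hρ, subst_update_absorb hx])
  have htρ : t.subst ρ = t := by
    conv_rhs => rw [← subst_var t]
    refine subst_congr fun y hy => ?_
    have : y ≠ x := fun h => hxt (h ▸ hy)
    simp [hρ, this]
  refine ⟨fun y => (ρ y).subst σ, ?_, fun τ hτ y => ?_⟩
  · intro e he
    rcases List.mem_cons.1 he with rfl | he
    · simp only [← subst_subst, htρ, Term.subst]
      simp [hρ]
    · simpa only [subst_subst] using hσ _ (List.mem_map.2 ⟨e, he, rfl⟩)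
  · have hτx : τ x = t.subst τ := hτ _ (List.mem_cons_self ..)
    have h1 : ∀ y, (σ y).subst τ = τ y := by
      refine hσ' τ fun e he => ?_
      obtain ⟨e', he', rfl⟩ := List.mem_map.1 he
      simpa only [hρ, subst_update_absorb hτx] using hτ e' (List.mem_cons_of_mem _ he')
    rw [subst_subst, subst_congr fun y _ => h1 y]
    simpa [Term.subst] using subst_update_absorb hτx (Term.var y)

theorem Unifies.swap {g : V → L.Term V} {s t : L.Term V} {E : List (L.Term V × L.Term V)}
    (h : Unifies g ((s, t) :: E)) : Unifies g ((t, s) :: E) := by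
  intro e he
  rcases List.mem_cons.1 he with rfl | he
  · exact (h _ (List.mem_cons_self ..)).symm
  · exact h e (List.mem_cons_of_mem _ he)

theorem IsIdempotentMGU.swap {σ : V → L.Term V} {s t : L.Term V}
    {E : List (L.Term V × L.Term V)} (h : IsIdempotentMGU σ ((s, t) :: E)) :
    IsIdempotentMGU σ ((t, s) :: E) :=
  ⟨h.1.swap, fun τ hτ => h.2 τ hτ.swap⟩

theorem unifies_func_cons_iff {g : V → L.Term V} {n : ℕ} {f : L.Functions n}
    {ts us : Fin n → L.Term V} {E : List (L.Term V × L.Term V)} :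
    Unifies g ((Term.func f ts, Term.func f us) :: E) ↔
      Unifies g (List.ofFn (fun i => (ts i, us i)) ++ E) := by
  simp only [Unifies, List.mem_cons, List.mem_append, List.mem_ofFn, or_imp, forall_and,
    forall_eq, Term.subst, Term.func.injEq, heq_eq_eq, true_and, funext_iff]
  simp

/-- The fixed solution `g` provides a termination measure: the total size of the `g`-instances of
the left sides. Variable elimination removes an equation of positive size, and decomposition removes
one function symbol. -/
theorem exists_mgu_list (g : V → L.Term V) (n : ℕ) :
    ∀ E : List (L.Term V × L.Term V), Unifies g E →
      (E.map fun e => size (e.1.subst g)).sum ≤ n → ∃ σ, IsIdempotentMGU σ E := by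
  induction n with
  | zero =>
    rintro (_ | ⟨e, E⟩) _ hE
    · exact ⟨Term.var, by simp [Unifies], fun τ _ x => rfl⟩
    · have := size_pos (e.1.subst g)
      simp at hE
      omega
  | succ n ih =>
    rintro (_ | ⟨⟨s, t⟩, E⟩) hg hE
    · exact ⟨Term.var, by simp [Unifies], fun τ _ x => rfl⟩
    have hgE : Unifies g E := fun e he => hg e (List.mem_cons_of_mem _ he)
    have hst : s.subst g = t.subst g := hg _ (List.mem_cons_self ..)
    have hpos := size_pos (s.subst g)
    simp only [List.map_cons, List.sum_cons] at hE
    have ih' : ∀ E' : List (L.Term V × L.Term V), Unifies g E' →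
        (E'.map fun e => size (e.1.subst g)).sum ≤ (E.map fun e => size (e.1.subst g)).sum →
        ∃ σ, IsIdempotentMGU σ E' := fun E' h1 h2 => ih E' h1 (by omega)
    cases s with
    | var x => exact exists_mgu_cons_var hgE hst ih'
    | func f ts =>
      cases t with
      | var x =>
        obtain ⟨σ, hσ⟩ := exists_mgu_cons_var hgE hst.symm ih'
        exact ⟨σ, hσ.swap⟩
      | func f' us =>
        obtain ⟨rfl, hf, -⟩ : _ ∧ _ ∧ _ := by simpa [Term.subst] using hst
        obtain rfl := eq_of_heq hf
        obtain ⟨σ, hσ, hσ'⟩ := ih (List.ofFn (fun i => (ts i, us i)) ++ E)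
          (unifies_func_cons_iff.1 hg) (by
            simp only [Term.subst, size] at hE
            simp only [List.map_append, List.map_ofFn, List.sum_append, List.sum_ofFn,
              Function.comp]
            omega)
        exact ⟨σ, unifies_func_cons_iff.2 hσ, fun τ hτ => hσ' τ (unifies_func_cons_iff.1 hτ)⟩

/-- Unifiable terms have a most general unifier. -/
theorem exists_isMGU {s t : L.Term V} {g : V → L.Term V} (h : s.subst g = t.subst g) :
    ∃ σ : Subst L V, IsMGU σ s t := by
  obtain ⟨σ, hσ, hσ'⟩ := exists_mgu_list g _ [(s, t)] (by simpa [Unifies] using h) le_rfl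
  have hF := (vars_finite s).union (vars_finite t)
  classical
  -- Cutting the unifier down to the variables of `s` and `t` makes its domain finite. On the other
  -- variables absorption is trivial, so `τ` itself serves as the factor `δ`.
  have hdom : {x | (if x ∈ vars s ∪ vars t then σ x else Term.var x) ≠ Term.var x}.Finite := by
    refine hF.subset fun x hx => ?_
    by_contra h
    exact hx (if_neg h)
  refine ⟨⟨fun x => if x ∈ vars s ∪ vars t then σ x else Term.var x, hdom⟩, ?_, ?_⟩
  · have h1 : s.subst σ = t.subst σ := hσ (s, t) (by simp)
    change s.subst _ = t.subst _
    rw [subst_congr (t := s) (h := σ) fun x hx => by simp [hx],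
      subst_congr (t := t) (h := σ) fun x hx => by simp [hx], h1]
  · intro τ hτ
    refine ⟨τ, fun x => ?_⟩
    simp only [Subst.app]
    split_ifs
    · exact (hσ' τ.toFun (by simpa [Unifies, Subst.app] using hτ) x).symm
    · rfl

end Unification

/-! ### Closure properties of rewriting and derivable rules -/

section Steps

variable {L : FirstOrder.Language.{u, v}} {V : Type w}

theorem update_subst {n : ℕ} (ts : Fin n → L.Term V) (i : Fin n) (t : L.Term V)
    (g : V → L.Term V) :
    (fun j => (Function.update ts i t j).subst g) =
      Function.update (fun j => (ts j).subst g) i (t.subst g) := by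
  funext j
  by_cases h : j = i
  · subst h; simp
  · simp [h]

theorem ReplaceAt.subst {p : List ℕ} {s a b t : L.Term V} (h : ReplaceAt p s a b t)
    (g : V → L.Term V) :
    ReplaceAt p (s.subst g) (a.subst g) (b.subst g) (t.subst g) := by
  induction h with
  | here a b => exact .here _ _
  | arg f ts i p a b t _ ih =>
    simp only [Term.subst, update_subst]
    exact .arg f _ i p _ _ _ ih

theorem ReplaceAt.exists_replace {p : List ℕ} {s a b t : L.Term V} (h : ReplaceAt p s a b t)
    (c : L.Term V) : ∃ t', ReplaceAt p s a c t' := by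
  induction h with
  | here a b => exact ⟨c, .here _ _⟩
  | arg f ts i p a b t _ ih =>
    obtain ⟨t', ht'⟩ := ih
    exact ⟨_, .arg f ts i p _ _ _ ht'⟩

theorem ReplaceAt.symm {p : List ℕ} {s a b t : L.Term V} (h : ReplaceAt p s a b t) :
    ReplaceAt p t b a s := by
  induction h with
  | here a b => exact .here _ _
  | arg f ts i p a b t _ ih =>
    have := ReplaceAt.arg f (Function.update ts i t) i p b a (ts i) (by simpa using ih)
    simpa using this

theorem ReplaceAt.trans {p q : List ℕ} {s a b t a' b' : L.Term V} (h : ReplaceAt p s a b t)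
    (h' : ReplaceAt q a a' b' b) : ReplaceAt (p ++ q) s a' b' t := by
  induction h with
  | here a b => exact h'
  | arg f ts i p a b t _ ih => exact .arg f ts i _ _ _ _ (ih h')

/-- Replacement is a congruence for reflexive transitive closures of relations that are closed
under contexts. -/
theorem ReplaceAt.lift {r : L.Term V → L.Term V → Prop}
    (hr : ∀ {n : ℕ} (f : L.Functions n) (ts : Fin n → L.Term V) (i : Fin n) (t : L.Term V),
      r (ts i) t → r (Term.func f ts) (Term.func f (Function.update ts i t)))
    {p : List ℕ} {s a b t : L.Term V} (h : ReplaceAt p s a b t) (hab : r a b) : r s t := by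
  induction h with
  | here a b => exact hab
  | arg f ts i p a b t _ ih => exact hr f ts i t (ih hab)

theorem stepBy_of_replaceAt {p : List ℕ} {l r s t : L.Term V} {g : V → L.Term V}
    (h : ReplaceAt p s (l.subst g) (r.subst g) t) : StepBy (eqn l r) s t := by
  obtain ⟨θ, hθ⟩ := exists_subst_eqOn ((vars_finite l).union (vars_finite r)) g
  refine ⟨p, l, r, θ, rfl, ?_⟩
  rw [Subst.app, Subst.app, subst_congr (t := l) (h := g) fun x hx => hθ x (Or.inl hx),
    subst_congr (t := r) (h := g) fun x hx => hθ x (Or.inr hx)]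
  exact h

theorem stepBy_eqn_iff {l r s t : L.Term V} :
    StepBy (eqn l r) s t ↔
      ∃ (p : List ℕ) (g : V → L.Term V), ReplaceAt p s (l.subst g) (r.subst g) t := by
  constructor
  · rintro ⟨p, l', r', θ, he, h⟩
    obtain ⟨g, h1, h2⟩ := instance_of_eqn_eq he.symm θ.toFun
    exact ⟨p, g, h1 ▸ h2 ▸ h⟩
  · rintro ⟨p, g, h⟩
    exact stepBy_of_replaceAt h

theorem stepBy_root (l r : L.Term V) (g : V → L.Term V) :
    StepBy (eqn l r) (l.subst g) (r.subst g) :=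
  stepBy_of_replaceAt (.here _ _)

theorem stepBy_self (l r : L.Term V) : StepBy (eqn l r) l r := by
  simpa only [subst_var] using stepBy_root l r Term.var

theorem StepBy.subst {e : Eqn L V} {s t : L.Term V} (h : StepBy e s t) (g : V → L.Term V) :
    StepBy e (s.subst g) (t.subst g) := by
  obtain ⟨l, r, rfl⟩ := exists_eqn e
  obtain ⟨p, k, h⟩ := stepBy_eqn_iff.1 h
  have := h.subst g
  simp only [subst_subst] at this
  exact stepBy_of_replaceAt this

theorem StepBy.replaceAt {e : Eqn L V} {p : List ℕ} {s a b t : L.Term V} (h : StepBy e a b)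
    (hp : ReplaceAt p s a b t) : StepBy e s t := by
  obtain ⟨q, l, r, θ, rfl, h⟩ := h
  exact ⟨_, l, r, θ, rfl, hp.trans h⟩

variable {R R' : Set (Eqn L V)}

theorem Step.mono (h : R ⊆ R') {s t : L.Term V} (hs : Step R s t) : Step R' s t :=
  let ⟨e, he, hs⟩ := hs
  ⟨e, h he, hs⟩

theorem Step.subst {s t : L.Term V} (h : Step R s t) (g : V → L.Term V) :
    Step R (s.subst g) (t.subst g) :=
  let ⟨e, he, h⟩ := h
  ⟨e, he, h.subst g⟩

theorem Step.replaceAt {p : List ℕ} {s a b t : L.Term V} (h : Step R a b)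
    (hp : ReplaceAt p s a b t) : Step R s t :=
  let ⟨e, he, h⟩ := h
  ⟨e, he, h.replaceAt hp⟩

theorem Step.update {n : ℕ} (f : L.Functions n) (ts : Fin n → L.Term V) (i : Fin n)
    {t : L.Term V} (h : Step R (ts i) t) :
    Step R (Term.func f ts) (Term.func f (Function.update ts i t)) :=
  h.replaceAt (.arg f ts i [] _ _ _ (.here _ _))

theorem Steps.refl (s : L.Term V) : Steps R s s := Relation.ReflTransGen.refl

theorem Steps.tail {s t t' : L.Term V} (h : Steps R s t) (h' : Step R t t') : Steps R s t' :=
  Relation.ReflTransGen.tail h h'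

theorem Steps.trans {s t t' : L.Term V} (h : Steps R s t) (h' : Steps R t t') : Steps R s t' :=
  Relation.ReflTransGen.trans h h'

theorem Step.steps {s t : L.Term V} (h : Step R s t) : Steps R s t :=
  Relation.ReflTransGen.single h

theorem Steps.mono (h : R ⊆ R') {s t : L.Term V} (hs : Steps R s t) : Steps R' s t := by
  induction hs with
  | refl => exact .refl _
  | tail _ hs ih => exact ih.tail (hs.mono h)

theorem Steps.subst {s t : L.Term V} (h : Steps R s t) (g : V → L.Term V) :
    Steps R (s.subst g) (t.subst g) := by
  induction h with
  | refl => exact .refl _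
  | tail _ h ih => exact ih.tail (h.subst g)

theorem Steps.update {n : ℕ} (f : L.Functions n) (ts : Fin n → L.Term V) (i : Fin n)
    {t : L.Term V} (h : Steps R (ts i) t) :
    Steps R (Term.func f ts) (Term.func f (Function.update ts i t)) := by
  induction h with
  | refl => simpa using Steps.refl _
  | @tail b c _ h ih =>
    refine Steps.tail ih ?_
    simpa using Step.update f (Function.update ts i b) i (by simpa using h)

theorem Steps.replaceAt {p : List ℕ} {s a b t : L.Term V} (h : Steps R a b)
    (hp : ReplaceAt p s a b t) : Steps R s t :=
  hp.lift (fun f ts i _ h => Steps.update f ts i h) h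

theorem Steps.func {n : ℕ} (f : L.Functions n) {ts us : Fin n → L.Term V}
    (h : ∀ i, Steps R (ts i) (us i)) : Steps R (Term.func f ts) (Term.func f us) := by
  -- The arguments are rewritten one at a time; `A` is the set of those already done.
  have key : ∀ A : Finset (Fin n),
      Steps R (Term.func f ts) (Term.func f fun i => if i ∈ A then us i else ts i) := by
    intro A
    induction A using Finset.induction_on with
    | empty => simpa using Steps.refl _
    | insert i A hi ih =>
      refine Steps.trans ih ?_
      convert Steps.update f (fun i => if i ∈ A then us i else ts i) i
        (t := us i) (by simpa [hi] using h i) using 2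
      funext j
      by_cases hj : j = i
      · subst hj; simp
      · simp [hj]
  simpa using key Finset.univ

theorem Steps.subst_pointwise {t : L.Term V} {g h : V → L.Term V}
    (H : ∀ x ∈ vars t, Steps R (g x) (h x)) : Steps R (t.subst g) (t.subst h) := by
  induction t with
  | var x => exact H x (by simp)
  | func f ts ih =>
    refine Steps.func f fun i => ih i fun x hx => H x ?_
    simpa using ⟨i, hx⟩

/-- Rules that are derivable from `R` induce derivable steps. -/
theorem StepBy.steps {l r s t : L.Term V} (h : StepBy (eqn l r) s t) (hlr : Steps R l r) :
    Steps R s t := by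
  obtain ⟨p, g, h⟩ := stepBy_eqn_iff.1 h
  exact (hlr.subst g).replaceAt h

theorem steps_of_derivable (H : ∀ e ∈ R', ∃ l r, e = eqn l r ∧ Steps R l r) {s t : L.Term V}
    (h : Steps R' s t) : Steps R s t := by
  induction h with
  | refl => exact .refl _
  | tail _ h ih =>
    obtain ⟨e, he, h⟩ := h
    obtain ⟨l, r, rfl, hlr⟩ := H e he
    exact Steps.trans ih (h.steps hlr)

theorem steps_of_eqn_mem {l r : L.Term V} (h : eqn l r ∈ R) : Steps R l r :=
  Step.steps ⟨_, h, stepBy_self l r⟩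

theorem exists_derivable_of_mem {e : Eqn L V} (h : e ∈ R) :
    ∃ l r, e = eqn l r ∧ Steps R l r := by
  obtain ⟨l, r, rfl⟩ := exists_eqn e
  exact ⟨l, r, rfl, steps_of_eqn_mem h⟩

theorem mem_symm_swap {l r : L.Term V} (h : eqn l r ∈ symm R) : eqn r l ∈ symm R := by
  rcases h with h | ⟨l', r', he, h⟩
  · exact Or.inr ⟨l, r, rfl, h⟩
  · obtain ⟨π, rfl, rfl⟩ := eqn_eq_iff.1 he.symm
    exact Or.inl (by rwa [eqn_relabel])

theorem steps_symm (hR : Reversible R) {s t : L.Term V} (h : Steps R s t) : Steps R t s := by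
  induction h with
  | refl => exact .refl _
  | tail _ h ih => exact Relation.ReflTransGen.trans (hR _ _ h) ih

theorem steps_of_steps_symm (hR : Reversible R) {s t : L.Term V}
    (h : Steps (Rewriting.symm R) s t) :
    Steps R s t := by
  refine steps_of_derivable (fun e he => ?_) h
  rcases he with he | ⟨l, r, rfl, he⟩
  · exact exists_derivable_of_mem he
  · exact ⟨r, l, rfl, steps_symm hR (steps_of_eqn_mem he)⟩

theorem steps_of_convs (hR : Reversible R) {s t : L.Term V} (h : Convs R s t) : Steps R s t := by
  induction h with
  | refl => exact .refl _
  | tail _ h ih =>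
    rcases h with h | h
    · exact Steps.tail ih h
    · exact Steps.trans ih (hR _ _ h)

theorem RewSeq.steps {s t : L.Term V} {A : Set (Eqn L V)} (h : RewSeq R s t A) :
    Steps (R ∩ A) s t := by
  induction h with
  | refl => exact .refl _
  | tail _ he hs ih =>
    refine Steps.tail
      (ih.mono (Set.inter_subset_inter_right _ (Set.subset_insert _ _))) ?_
    exact ⟨_, ⟨he, Set.mem_insert _ _⟩, hs⟩

end Steps

/-! ### Parallel steps -/

section Parallel

variable {L : FirstOrder.Language.{u, v}} {V : Type w} {R : Set (Eqn L V)}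

theorem Par.refl (t : L.Term V) : Par R t t := by
  induction t with
  | var x => exact .var x
  | func f ts ih => exact .func f ts ts ih

theorem Par.root_subst {l r : L.Term V} (h : eqn l r ∈ R) (g : V → L.Term V) :
    Par R (l.subst g) (r.subst g) := by
  obtain ⟨θ, hθ⟩ := exists_subst_eqOn ((vars_finite l).union (vars_finite r)) g
  have := Par.root l r θ h
  rwa [Subst.app, Subst.app, subst_congr (t := l) (h := g) fun x hx => hθ x (Or.inl hx),
    subst_congr (t := r) (h := g) fun x hx => hθ x (Or.inr hx)] at this

theorem Par.subst {s t : L.Term V} (h : Par R s t) (g : V → L.Term V) :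
    Par R (s.subst g) (t.subst g) := by
  induction h with
  | var x => exact .refl _
  | root l r θ h =>
    simp only [Subst.app, subst_subst]
    exact .root_subst h _
  | func f ts us _ ih => exact .func f _ _ ih

/-- This is what single steps lack: a variable may occur repeatedly in `t`, and all its copies are
contracted in one parallel step. -/
theorem Par.subst_pointwise {t : L.Term V} {g h : V → L.Term V}
    (H : ∀ x ∈ vars t, Par R (g x) (h x)) : Par R (t.subst g) (t.subst h) := by
  induction t with
  | var x => exact H x (by simp)
  | func f ts ih =>
    refine Par.func f _ _ fun i => ih i fun x hx => H x ?_
    simpa using ⟨i, hx⟩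

theorem Par.update {n : ℕ} (f : L.Functions n) {ts us : Fin n → L.Term V} (i : Fin n)
    {t u : L.Term V} (h : ∀ j, Par R (ts j) (us j)) (htu : Par R t u) :
    Par R (Term.func f (Function.update ts i t)) (Term.func f (Function.update us i u)) := by
  refine .func f _ _ fun j => ?_
  by_cases hj : j = i
  · subst hj; simpa using htu
  · simpa [hj] using h j

theorem Step.par {s t : L.Term V} (h : Step R s t) : Par R s t := by
  obtain ⟨e, he, p, l, r, θ, rfl, h⟩ := h
  refine h.lift (fun f ts i t ht => ?_) (Par.root l r θ he)
  simpa using Par.update f (ts := ts) i (fun j => Par.refl _) ht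

theorem Par.steps {s t : L.Term V} (h : Par R s t) : Steps R s t := by
  induction h with
  | var x => exact .refl _
  | root l r θ h => exact Step.steps ⟨_, h, stepBy_root l r _⟩
  | func f ts us _ ih => exact Steps.func f ih

theorem Par.symm {s t : L.Term V} (h : Par (Rewriting.symm R) s t) :
    Par (Rewriting.symm R) t s := by
  induction h with
  | var x => exact .var x
  | root l r θ h => exact .root r l θ (mem_symm_swap h)
  | func f ts us _ ih => exact .func f _ _ ih

end Parallel

/-! ### Critical overlaps and steps inside the substitution -/

section Overlaps

variable {L : FirstOrder.Language.{u, v}} {V : Type w}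

theorem ReplaceAt.vars_subset {p : List ℕ} {s a b t : L.Term V} (h : ReplaceAt p s a b t) :
    vars a ⊆ vars s := by
  induction h with
  | here a b => exact subset_rfl
  | arg f ts i p a b t _ ih =>
    rw [vars_func]
    exact ih.trans (Set.subset_iUnion (fun i => vars (ts i)) i)

/-- A replacement in an instance of `l` takes place at a function position of `l` or below a
variable of `l`. -/
theorem replaceAt_subst_cases [DecidableEq V] {p : List ℕ} {l a b t : L.Term V}
    {g : V → L.Term V} (h : ReplaceAt p (l.subst g) a b t) :
    (∃ s, ¬ IsVar s ∧ a = s.subst g ∧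
      ∀ c, ∃ w, ReplaceAt p l s c w ∧ (c.subst g = b → w.subst g = t)) ∨
    ∃ x ∈ vars l, ∃ q u, ReplaceAt q (g x) a b u ∧
      ∀ R, Steps R a b → Steps R t (l.subst (Function.update g x u)) := by
  induction l generalizing p t with
  | var x =>
    refine Or.inr ⟨x, by simp, p, t, h, fun R _ => ?_⟩
    simpa [Term.subst] using Steps.refl _
  | func f ts ih =>
    simp only [Term.subst] at h
    cases h with
    | here =>
      exact Or.inl ⟨Term.func f ts, by rintro ⟨x, ⟨⟩⟩, rfl, fun c => ⟨c, .here _ _, id⟩⟩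
    | arg _ _ i p a b t h =>
      rcases ih i h with ⟨s, hs, rfl, H⟩ | ⟨x, hx, q, u, hq, H⟩
      · refine Or.inl ⟨s, hs, rfl, fun c => ?_⟩
        obtain ⟨w, hw, hw'⟩ := H c
        refine ⟨_, .arg f ts i p _ _ _ hw, fun hc => ?_⟩
        simp only [Term.subst, update_subst, hw' hc]
      · refine Or.inr ⟨x, by simpa using ⟨i, hx⟩, q, u, hq, fun R hR => ?_⟩
        simp only [Term.subst]
        -- The other arguments may contain further copies of `x`; these have to be rewritten too
        -- before the term is again an instance of `l`.
        refine Steps.func f fun j => ?_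
        by_cases hj : j = i
        · subst hj
          simpa using H R hR
        · rw [Function.update_of_ne hj]
          refine Steps.subst_pointwise fun y _ => ?_
          by_cases hy : y = x
          · subst hy
            simpa using hR.replaceAt hq
          · simpa [hy] using Steps.refl _

/-- A rule can be renamed apart from a finite set of variables so that its instance and a given
substitution on that set become instances of a single substitution. -/
theorem exists_common_instance [Infinite V] {F : Set V} (hF : F.Finite) (l r : L.Term V)
    (g h : V → L.Term V) :
    ∃ l' r' : L.Term V, eqn l r = eqn l' r' ∧ Disjoint (vars l' ∪ vars r') F ∧
      ∃ k : V → L.Term V, (∀ x ∈ F, k x = g x) ∧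
        l.subst h = l'.subst k ∧ r.subst h = r'.subst k := by
  classical
  obtain ⟨l', r', he, hd⟩ := exists_variant_disjoint hF (eqn l r)
  obtain ⟨h', h1, h2⟩ := instance_of_eqn_eq he h
  refine ⟨l', r', he, hd, fun x => if x ∈ F then g x else h' x, fun x hx => if_pos hx, ?_, ?_⟩
  · rw [h1]
    exact subst_congr fun x hx => (if_neg (Set.disjoint_left.1 hd (Or.inl hx))).symm
  · rw [h2]
    exact subst_congr fun x hx => (if_neg (Set.disjoint_left.1 hd (Or.inr hx))).symm

/-- Every overlap of instances is an instance of a critical pair. -/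
theorem exists_criticalPair_instance {p : List ℕ} {l₁ r₁ l₂ r₂ s w : L.Term V}
    {g : V → L.Term V} (hd : Disjoint (vars l₁ ∪ vars r₁) (vars l₂ ∪ vars r₂))
    (hw : ReplaceAt p l₂ s r₁ w) (hs : ¬ IsVar s) (hg : l₁.subst g = s.subst g)
    (hne : ¬ (eqn l₁ r₁ = eqn l₂ r₂ ∧ p = [])) :
    ∃ a b, IsCriticalPair p (eqn l₁ r₁) (eqn l₂ r₂) a b ∧
      ∃ k : V → L.Term V, w.subst g = a.subst k ∧ r₂.subst g = b.subst k := by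
  obtain ⟨σ, hσ⟩ := exists_isMGU hg
  obtain ⟨τ, hτ⟩ := exists_subst_eqOn
    (((vars_finite l₁).union (vars_finite s)).union ((vars_finite w).union (vars_finite r₂))) g
  have e1 : l₁.subst τ.toFun = l₁.subst g := subst_congr fun x hx => hτ x (Or.inl (Or.inl hx))
  have e2 : s.subst τ.toFun = s.subst g := subst_congr fun x hx => hτ x (Or.inl (Or.inr hx))
  have e3 : w.subst τ.toFun = w.subst g := subst_congr fun x hx => hτ x (Or.inr (Or.inl hx))
  have e4 : r₂.subst τ.toFun = r₂.subst g := subst_congr fun x hx => hτ x (Or.inr (Or.inr hx))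
  obtain ⟨δ, hδ⟩ := hσ.2 τ (by rw [Subst.app, Subst.app, e1, e2, hg])
  have hfac : ∀ t : L.Term V, t.subst τ.toFun = (σ.app t).subst δ.toFun := fun t => by
    rw [Subst.app, subst_subst]
    exact subst_congr fun x _ => hδ x
  refine ⟨σ.app w, σ.app r₂,
    ⟨l₁, r₁, l₂, r₂, s, w, σ, rfl, rfl, hd, hw, hs, hσ, hne, rfl, rfl⟩, δ.toFun, ?_, ?_⟩
  · rw [← e3, hfac]
  · rw [← e4, hfac]

theorem IsCriticalPair.exists_peak {p : List ℕ} {e₁ e₂ : Eqn L V} {a b : L.Term V}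
    (h : IsCriticalPair p e₁ e₂ a b) : ∃ m, StepBy e₁ m a ∧ StepBy e₂ m b := by
  obtain ⟨l₁, r₁, l₂, r₂, s, w, σ, rfl, rfl, -, hw, -, hσ, -, rfl, rfl⟩ := h
  refine ⟨σ.app l₂, ?_, stepBy_root l₂ r₂ _⟩
  have := hw.subst σ.toFun
  rw [show s.subst σ.toFun = l₁.subst σ.toFun from hσ.1.symm] at this
  exact stepBy_of_replaceAt this

theorem exists_peak_of_mem_CP {A B : Set (Eqn L V)} {a b : L.Term V} (h : eqn a b ∈ CP A B) :
    ∃ m, Step A m a ∧ Step B m b := by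
  obtain ⟨p, e₁, h₁, e₂, h₂, a', b', hcp, he⟩ : ∃ p, ∃ e₁ ∈ A, ∃ e₂ ∈ B, ∃ a' b',
      IsCriticalPair p e₁ e₂ a' b' ∧ eqn a b = eqn a' b' := by
    rcases h with ⟨e₁, h₁, e₂, h₂, a', b', hcp, he⟩ | ⟨e₁, h₁, e₂, h₂, p, a', b', -, hcp, he⟩
    · exact ⟨_, e₁, h₁, e₂, h₂, a', b', hcp, he⟩
    · exact ⟨p, e₁, h₁, e₂, h₂, a', b', hcp, he⟩
  obtain ⟨m, hm₁, hm₂⟩ := hcp.exists_peak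
  obtain ⟨g, hg₁, hg₂⟩ := instance_of_eqn_eq he Term.var
  rw [subst_var] at hg₁ hg₂
  exact ⟨m.subst g, ⟨e₁, h₁, hg₁ ▸ hm₁.subst g⟩, ⟨e₂, h₂, hg₂ ▸ hm₂.subst g⟩⟩

theorem IsCriticalPair.mem_CP {A B : Set (Eqn L V)} {p : List ℕ} {e₁ e₂ : Eqn L V}
    {a b : L.Term V} (h : IsCriticalPair p e₁ e₂ a b) (h₁ : e₁ ∈ A) (h₂ : e₂ ∈ B) :
    eqn a b ∈ CP A B := by
  by_cases hp : p = []
  · subst hp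
    exact Or.inl ⟨e₁, h₁, e₂, h₂, a, b, h, rfl⟩
  · exact Or.inr ⟨e₁, h₁, e₂, h₂, p, a, b, hp, h, rfl⟩

/-- A step by `e` from an instance of the left-hand side of `l → r` is a critical overlap, a root
step by the same rule, or a step in the substitution. -/
theorem stepBy_instance_cases [Infinite V] [DecidableEq V] {e : Eqn L V} {l t : L.Term V}
    {g : V → L.Term V} (h : StepBy e (l.subst g) t) (r : L.Term V) :
    (∃ p a b, IsCriticalPair p e (eqn l r) a b ∧
      ∃ k : V → L.Term V, t = a.subst k ∧ r.subst g = b.subst k) ∨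
    (e = eqn l r ∧ ∃ k : V → L.Term V, l.subst g = l.subst k ∧ t = r.subst k) ∨
    ∃ x ∈ vars l, ∃ u, StepBy e (g x) u ∧ Steps {e} t (l.subst (Function.update g x u)) := by
  obtain ⟨p, l₁, r₁, θ, rfl, h⟩ := h
  obtain ⟨l', r', he, hd, k, hk, hl, hr⟩ := exists_common_instance
    ((vars_finite l).union (vars_finite r)) l₁ r₁ g θ.toFun
  have hlk : l.subst g = l.subst k := subst_congr fun x hx => (hk x (Or.inl hx)).symm
  have hrk : r.subst g = r.subst k := subst_congr fun x hx => (hk x (Or.inr hx)).symm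
  -- A root overlap of a rule with itself is excluded from the critical pairs and is treated apart.
  by_cases hsame : eqn l₁ r₁ = eqn l r ∧ p = []
  · obtain ⟨hsame, rfl⟩ := hsame
    refine Or.inr (Or.inl ⟨hsame, ?_⟩)
    obtain ⟨k', h1, h2⟩ := instance_of_eqn_eq hsame θ.toFun
    generalize hz : l.subst g = z at h
    cases h
    exact ⟨k', h1, h2⟩
  rw [hlk, Subst.app, hl, Subst.app, hr] at h
  rcases replaceAt_subst_cases h with ⟨s, hs, hsl, H⟩ | ⟨x, hx, q, u, hq, H⟩
  · left
    obtain ⟨w, hw, hwt⟩ := H r'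
    rw [he] at hsame ⊢
    obtain ⟨a, b, hab, k', h1, h2⟩ := exists_criticalPair_instance hd hw hs hsl hsame
    exact ⟨p, a, b, hab, k', by rw [← h1, hwt rfl], by rw [hrk, h2]⟩
  · rw [he]
    refine Or.inr (Or.inr ⟨x, hx, u, ?_, ?_⟩)
    · rw [← hk x (Or.inl hx)]
      exact stepBy_of_replaceAt hq
    · rw [subst_congr (h := Function.update k x u)]
      · exact H _ (Step.steps ⟨_, rfl, stepBy_root l' r' _⟩)
      · intro y hy
        by_cases hyx : y = x
        · subst hyx; simp
        · simp [hyx, hk y (Or.inl hy)]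

/-- An instance of a left-hand side at a proper function position yields an inner critical
pair. -/
theorem CPin_nonempty_of_instance [Infinite V] {A B : Set (Eqn L V)} {p : List ℕ}
    {l₁ r₁ l r s t : L.Term V} {g h : V → L.Term V} (h₁ : eqn l₁ r₁ ∈ A) (h₂ : eqn l r ∈ B)
    (hp : p ≠ []) (hs : ReplaceAt p l s s t) (hv : ¬ IsVar s) (hgh : l₁.subst h = s.subst g) :
    (CPin A B).Nonempty := by
  obtain ⟨l', r', he, hd, k, hk, hl, -⟩ := exists_common_instance
    ((vars_finite l).union (vars_finite r)) l₁ r₁ g h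
  obtain ⟨w, hw⟩ := hs.exists_replace r'
  obtain ⟨a, b, hab, -⟩ := exists_criticalPair_instance (g := k) hd hw hv
    (by
      rw [← hl, hgh]
      exact subst_congr fun x hx => (hk x (Or.inl (hs.vars_subset hx))).symm)
    fun h => hp h.2
  exact ⟨_, _, he ▸ h₁, _, h₂, p, a, b, hp, hab, rfl⟩

/-- Substitutions for terms with pairwise disjoint variables can be merged. -/
theorem exists_merge_subst {n : ℕ} {ls : Fin n → L.Term V}
    (hd : ∀ i j, i ≠ j → Disjoint (vars (ls i)) (vars (ls j))) (g : Fin n → V → L.Term V) :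
    ∃ k : V → L.Term V, ∀ i, ∀ x ∈ vars (ls i), k x = g i x := by
  classical
  refine ⟨fun x => if h : ∃ i, x ∈ vars (ls i) then g h.choose x else Term.var x,
    fun i x hx => ?_⟩
  have h : ∃ i, x ∈ vars (ls i) := ⟨i, hx⟩
  have hi : h.choose = i := by
    by_contra hne
    exact Set.disjoint_left.1 (hd _ _ hne) h.choose_spec hx
  simp only [dif_pos h, hi]

theorem exists_merge_par {Q : Set (Eqn L V)} {n : ℕ} {ls us : Fin n → L.Term V}
    (hd : ∀ i j, i ≠ j → Disjoint (vars (ls i)) (vars (ls j))) {g : V → L.Term V}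
    (h : ∀ i, ∃ k : V → L.Term V, us i = (ls i).subst k ∧ ∀ x ∈ vars (ls i), Par Q (g x) (k x)) :
    ∃ k : V → L.Term V, (∀ i, us i = (ls i).subst k) ∧
      ∀ i, ∀ x ∈ vars (ls i), Par Q (g x) (k x) := by
  choose k hk hp using h
  obtain ⟨k', hk'⟩ := exists_merge_subst hd k
  refine ⟨k', fun i => ?_, fun i x hx => ?_⟩
  · rw [hk i]
    exact subst_congr fun x hx => (hk' i x hx).symm
  · rw [hk' i x hx]
    exact hp i x hx

theorem replaceAt_arg_self {n : ℕ} (f : L.Functions n) (ls : Fin n → L.Term V) (i : Fin n)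
    {p : List ℕ} {s : L.Term V} (h : ReplaceAt p (ls i) s s (ls i)) :
    ReplaceAt ((i : ℕ) :: p) (Term.func f ls) s s (Term.func f ls) := by
  have := ReplaceAt.arg f ls i p s s (ls i) h
  rwa [Function.update_eq_self] at this

/-- Parallel steps from an instance of a linear term without overlaps stay in the
substitution. -/
theorem par_linear_instance {Q : Set (Eqn L V)} {l : L.Term V} (hl : Linear l)
    {g : V → L.Term V}
    (hno : ∀ p s, ReplaceAt p l s s l → ¬ IsVar s →
      ∀ (l₁ r₁ : L.Term V) (h : V → L.Term V), eqn l₁ r₁ ∈ Q → l₁.subst h ≠ s.subst g)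
    {y : L.Term V} (hy : Par Q (l.subst g) y) :
    ∃ k : V → L.Term V, y = l.subst k ∧ ∀ x ∈ vars l, Par Q (g x) (k x) := by
  induction l generalizing y with
  | var x =>
    -- Only the value at `x` matters, so a constant map will do.
    refine ⟨fun _ => y, rfl, fun z hz => ?_⟩
    obtain rfl : z = x := by simpa using hz
    exact hy
  | func f ls ih =>
    generalize hz : (Term.func f ls).subst g = z at hy
    cases hy with
    | var x => simp [Term.subst] at hz
    | root l₁ r₁ θ h => exact absurd hz.symm (hno [] _ (.here _ _) (by rintro ⟨x, ⟨⟩⟩) _ _ _ h)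
    | func f' ts us h =>
      obtain ⟨rfl, hf, hts⟩ : _ ∧ _ ∧ _ := by simpa [Term.subst] using hz
      obtain rfl := eq_of_heq hf
      obtain rfl := eq_of_heq hts
      -- Linearity enters here: the arguments share no variables, so their substitutions can be
      -- merged.
      obtain ⟨k, hk, hp⟩ := exists_merge_par hl.2 fun i => ih i (hl.1 i)
        (fun p s hs => hno _ s (replaceAt_arg_self f ls i hs)) (h i)
      refine ⟨k, ?_, fun x hx => ?_⟩
      · simp only [Term.subst, ← hk]
      · simp only [vars_func, Set.mem_iUnion] at hx
        obtain ⟨i, hi⟩ := hx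
        exact hp i x hi

end Overlaps

/-! ### Local peaks -/

section Peaks

variable {L : FirstOrder.Language.{u, v}} {V : Type w} {S T Q : Set (Eqn L V)}

/-- `t` equals `s`, or is reached from `s` by a `T`-reduction that starts with an `S`-step. -/
def HeadSteps (S T : Set (Eqn L V)) (s t : L.Term V) : Prop :=
  s = t ∨ ∃ w, Step S s w ∧ Steps T w t

theorem HeadSteps.steps (hST : S ⊆ T) {s t : L.Term V} (h : HeadSteps S T s t) : Steps T s t := by
  rcases h with rfl | ⟨w, h1, h2⟩
  · exact .refl _
  · exact (h1.mono hST).steps.trans h2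

theorem HeadSteps.trans (hST : S ⊆ T) {s t t' : L.Term V} (h : HeadSteps S T s t)
    (h' : HeadSteps S T t t') : HeadSteps S T s t' := by
  rcases h with rfl | ⟨w, h1, h2⟩
  · exact h'
  · exact Or.inr ⟨w, h1, h2.trans (h'.steps hST)⟩

theorem Steps.headSteps (hST : S ⊆ T) {s t : L.Term V} (h : Steps S s t) : HeadSteps S T s t := by
  rcases Relation.ReflTransGen.cases_head h with h | ⟨w, h1, h2⟩
  · exact Or.inl h
  · exact Or.inr ⟨w, h1, Steps.mono hST h2⟩

theorem HeadSteps.subst {s t : L.Term V} (h : HeadSteps S T s t) (g : V → L.Term V) :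
    HeadSteps S T (s.subst g) (t.subst g) := by
  rcases h with rfl | ⟨w, h1, h2⟩
  · exact Or.inl rfl
  · exact Or.inr ⟨_, h1.subst g, h2.subst g⟩

theorem HeadSteps.update {n : ℕ} (f : L.Functions n) (ts : Fin n → L.Term V) (i : Fin n)
    {t : L.Term V} (h : HeadSteps S T (ts i) t) :
    HeadSteps S T (Term.func f ts) (Term.func f (Function.update ts i t)) := by
  rcases h with rfl | ⟨w, h1, h2⟩
  · exact Or.inl (by simp)
  · refine Or.inr ⟨_, Step.update f ts i h1, ?_⟩
    simpa using Steps.update f (Function.update ts i w) i (by simpa using h2)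

/-- `s` and `t` have `T`-reducts that are related by a parallel `Q`-step. -/
def ParJoinable (T Q : Set (Eqn L V)) (s t : L.Term V) : Prop :=
  ∃ u v, Steps T s u ∧ Steps T t v ∧ Par Q u v

/-- As `ParJoinable`, where a nontrivial reduction from `t` starts with an `S`-step. -/
def HeadParJoinable (S T Q : Set (Eqn L V)) (s t : L.Term V) : Prop :=
  ∃ u v, Steps T s u ∧ HeadSteps S T t v ∧ Par Q u v

theorem ParJoinable.symm {P : Set (Eqn L V)} {s t : L.Term V}
    (h : ParJoinable T (Rewriting.symm P) s t) : ParJoinable T (Rewriting.symm P) t s :=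
  let ⟨u, v, h1, h2, h3⟩ := h
  ⟨v, u, h2, h1, h3.symm⟩

theorem ParJoinable.subst {s t : L.Term V} (h : ParJoinable T Q s t) (g : V → L.Term V) :
    ParJoinable T Q (s.subst g) (t.subst g) :=
  let ⟨_, _, h1, h2, h3⟩ := h
  ⟨_, _, h1.subst g, h2.subst g, h3.subst g⟩

theorem HeadParJoinable.subst {s t : L.Term V} (h : HeadParJoinable S T Q s t)
    (g : V → L.Term V) : HeadParJoinable S T Q (s.subst g) (t.subst g) :=
  let ⟨_, _, h1, h2, h3⟩ := h
  ⟨_, _, h1.subst g, h2.subst g, h3.subst g⟩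

/-- All left-hand sides are no variables and contain the variables of the right-hand sides. -/
def ProperRules (S : Set (Eqn L V)) : Prop :=
  ∀ l r, eqn l r ∈ S → ¬ IsVar l ∧ vars r ⊆ vars l

theorem steps_subst_update [DecidableEq V] {g : V → L.Term V} {x : V} {u : L.Term V}
    (h : Steps S (g x) u) (t : L.Term V) :
    Steps S (t.subst g) (t.subst (Function.update g x u)) := by
  refine Steps.subst_pointwise fun y _ => ?_
  by_cases hy : y = x
  · subst hy; simpa using h
  · simpa [hy] using Steps.refl _

theorem root_peak_parJoinable [Infinite V] (hST : S ⊆ T) (hS : ProperRules S)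
    (hcp : ∀ a b, eqn a b ∈ CP S S → ParJoinable T Q a b) {l r t : L.Term V}
    {g : V → L.Term V} (hlr : eqn l r ∈ S) (ht : Step S (l.subst g) t) :
    ParJoinable T Q t (r.subst g) := by
  classical
  obtain ⟨e, he, ht⟩ := ht
  rcases stepBy_instance_cases ht r with
    ⟨p, a, b, hab, k, rfl, hb⟩ | ⟨-, k, hk, rfl⟩ | ⟨x, hx, u, hu, ht⟩
  · rw [hb]
    exact (hcp a b (hab.mem_CP he hlr)).subst k
  · rw [subst_congr fun x hx => eqOn_vars_of_subst_eq hk x ((hS l r hlr).2 hx)]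
    exact ⟨_, _, .refl _, .refl _, .refl _⟩
  · have heT : {e} ⊆ T := by simpa using hST he
    refine ⟨_, _, (ht.mono heT).tail ⟨_, hST hlr, stepBy_root l r _⟩,
      steps_subst_update (Step.steps ⟨e, hST he, hu⟩) r, .refl _⟩

/-- Compare the two positions. If one is the root, the peak is an instance of a critical pair, a
root step by one and the same rule, or a variable overlap. Steps in different arguments commute, and
steps in the same argument are handled by induction. -/
theorem peak_parJoinable [Infinite V] {P : Set (Eqn L V)} (hST : S ⊆ T) (hS : ProperRules S)
    (hcp : ∀ a b, eqn a b ∈ CP S S → ParJoinable T (symm P) a b) {s t t' : L.Term V}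
    (h : Step S s t) (h' : Step S s t') : ParJoinable T (symm P) t t' := by
  obtain ⟨e, he, p, l, r, θ, rfl, h⟩ := h
  generalize ha : θ.app l = a at h
  generalize hb : θ.app r = b at h
  induction h generalizing t' with
  | here a b =>
    subst ha hb
    exact (root_peak_parJoinable hST hS hcp he h').symm
  | arg f ts i p a b t h ih =>
    obtain ⟨e', he', q, l', r', θ', rfl, h'⟩ := h'
    subst ha hb
    generalize hs : Term.func f ts = s at h'
    generalize ha : θ'.app l' = a at h'
    generalize hb : θ'.app r' = b at h'
    cases h' with
    | here =>
      subst ha hb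
      exact root_peak_parJoinable hST hS hcp he'
        ⟨_, he, by
          rw [show l'.subst θ'.toFun = _ from hs.symm]
          exact stepBy_of_replaceAt (.arg f ts i p _ _ t h)⟩
    | arg f' ts' j q _ _ t' h' =>
      subst ha hb
      cases hs
      by_cases hij : i = j
      · subst hij
        obtain ⟨u, v, h1, h2, h3⟩ := ih ⟨_, he', q, l', r', θ', rfl, h'⟩ rfl rfl
        refine ⟨Term.func f (Function.update ts i u), Term.func f (Function.update ts i v),
          ?_, ?_, Par.update f i (fun _ => .refl _) h3⟩
        · simpa using Steps.update f (Function.update ts i t) i (by simpa using h1)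
        · simpa using Steps.update f (Function.update ts i t') i (by simpa using h2)
      · refine ⟨Term.func f (Function.update (Function.update ts i t) j t'), _, ?_, ?_, .refl _⟩
        · refine Steps.update f _ j (Step.steps ⟨_, hST he', ?_⟩)
          rw [Function.update_of_ne (Ne.symm hij)]
          exact stepBy_of_replaceAt h'
        · rw [Function.update_comm hij]
          refine Steps.update f _ i (Step.steps ⟨_, hST he, ?_⟩)
          rw [Function.update_of_ne hij]
          exact stepBy_of_replaceAt h

/-- If the parallel step contracts the root, the `S`-step is compared with that single redex. If it
acts in the arguments, an `S`-step at the root has a redex that survives, by left-linearity and the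
absence of inner overlaps, and an `S`-step in an argument is treated by induction. -/
theorem par_peak_headParJoinable [Infinite V] (hST : S ⊆ T) (hS : ProperRules S)
    (hlin : LeftLinear S) (hin : CPin Q S = ∅)
    (hcp : ∀ a b, eqn a b ∈ CP S Q → HeadParJoinable S T Q a b) {s t t' : L.Term V}
    (h : Step S s t) (h' : Par Q s t') : HeadParJoinable S T Q t t' := by
  classical
  induction h' generalizing t with
  | var x =>
    obtain ⟨e, he, p, l, r, θ, rfl, h⟩ := h
    generalize ha : θ.app l = a at h
    cases h
    cases l with
    | var y => exact absurd ⟨y, rfl⟩ (hS _ _ he).1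
    | func f ts => simp [Subst.app, Term.subst] at ha
  | root l r θ hlr =>
    obtain ⟨e, he, h⟩ := h
    rcases stepBy_instance_cases h r with
      ⟨p, a, b, hab, k, rfl, hb⟩ | ⟨rfl, k, hk, rfl⟩ | ⟨x, hx, u, hu, h⟩
    · rw [Subst.app, hb]
      exact (hcp a b (hab.mem_CP he hlr)).subst k
    -- `S` and `Q` may share a rule. Its right-hand side has no extra variables, so both root
    -- contractions give the same term.
    · rw [Subst.app, subst_congr fun x hx => eqOn_vars_of_subst_eq hk x ((hS l r he).2 hx)]
      exact ⟨_, _, .refl _, Or.inl rfl, .refl _⟩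
    · have heT : {e} ⊆ T := by simpa using hST he
      exact ⟨_, _, h.mono heT,
        (steps_subst_update (S := S) (Step.steps ⟨e, he, hu⟩) r).headSteps hST,
        .root_subst hlr _⟩
  | func f ts us hpar ih =>
    obtain ⟨e, he, p, l, r, θ, rfl, h⟩ := h
    generalize hs : Term.func f ts = s at h
    generalize ha : θ.app l = a at h
    generalize hb : θ.app r = b at h
    cases h with
    | here =>
      subst hb hs
      cases l with
      | var y => exact absurd ⟨y, rfl⟩ (hS _ _ he).1
      | func f' ls =>
        obtain ⟨rfl, hf, hts⟩ : _ ∧ _ ∧ _ := by simpa [Subst.app, Term.subst] using ha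
        obtain rfl := eq_of_heq hf
        obtain rfl := eq_of_heq hts
        have hl := hlin _ _ he
        obtain ⟨k, hk, hp⟩ := exists_merge_par hl.2 fun i => par_linear_instance (hl.1 i)
          (fun p s hs hv l₁ r₁ h h₁ hgh => by
            have := CPin_nonempty_of_instance h₁ he (List.cons_ne_nil _ _)
              (replaceAt_arg_self f' ls i hs) hv hgh
            simp [hin] at this) (hpar i)
        -- The parallel step changes only the substitution, from `θ` to `k`. The `S`-rule still
        -- applies on the other side, and the contracta differ by a parallel step in the
        -- substitution.
        refine ⟨r.subst θ.toFun, r.subst k, .refl _, Or.inr ⟨_, ⟨_, he, ?_⟩, .refl _⟩,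
          Par.subst_pointwise fun x hx => ?_⟩
        · obtain rfl : us = fun i => (ls i).subst k := funext hk
          exact stepBy_root _ r k
        · have hx' := (hS _ _ he).2 hx
          simp only [vars_func, Set.mem_iUnion] at hx'
          obtain ⟨i, hi⟩ := hx'
          exact hp i x hi
    | arg f' ts' i p _ _ t h =>
      subst ha hb
      cases hs
      obtain ⟨u, v, h1, h2, h3⟩ := ih i ⟨_, he, p, l, r, θ, rfl, h⟩
      -- The contractions in the arguments other than `i` are postponed to the closing parallel
      -- step.
      refine ⟨Term.func f (Function.update ts i u), Term.func f (Function.update us i v),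
        ?_, HeadSteps.update f us i h2, Par.update f i hpar h3⟩
      simpa using Steps.update f (Function.update ts i t) i (by simpa using h1)

end Peaks

/-! ### Confluence modulo the reversible part -/

section Confluence

variable {L : FirstOrder.Language.{u, v}} {V : Type w}

theorem ReplaceAt.exists_of_mem_vars {t : L.Term V} {x : V} (hx : x ∈ vars t)
    (g : V → L.Term V) (b : L.Term V) : ∃ p t', ReplaceAt p (t.subst g) (g x) b t' := by
  induction t with
  | var y =>
    obtain rfl : x = y := by simpa using hx
    exact ⟨[], b, .here _ _⟩
  | func f ts ih =>
    simp only [vars_func, Set.mem_iUnion] at hx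
    obtain ⟨i, hi⟩ := hx
    obtain ⟨p, t', h⟩ := ih i hi
    exact ⟨_, _, .arg f (fun i => (ts i).subst g) i p _ _ _ h⟩

/-- A variable as left-hand side would make every term reducible. If a variable `y` of `r` were
missing from `l`, instantiating it by `l` would give a step from `l` to a term containing `l`. -/
theorem Terminating.properRules {S : Set (Eqn L V)} (hS : Terminating S) : ProperRules S := by
  classical
  intro l r hlr
  constructor
  · rintro ⟨x, rfl⟩
    have : ∀ t : L.Term V, False := fun t => by
      induction t using hS.induction with
      | _ t ih =>
        exact ih _ ⟨_, hlr, stepBy_of_replaceAt (p := []) (g := fun _ => t) (.here _ _)⟩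
    exact this r
  · intro y hy
    by_contra hyl
    set g : V → L.Term V := Function.update Term.var y l with hg
    have hl : l.subst g = l := by
      conv_rhs => rw [← subst_var l]
      refine subst_congr fun x hx => ?_
      have : x ≠ y := fun h => hyl (h ▸ hx)
      simp [hg, this]
    have : ∀ t : L.Term V, ¬ ∃ p t', ReplaceAt p t l l t' := fun t => by
      induction t using hS.induction with
      | _ t ih =>
        rintro ⟨p, t', h⟩
        obtain ⟨t'', h⟩ := h.exists_replace (r.subst g)
        refine ih t'' ⟨_, hlr, stepBy_of_replaceAt (g := g) (by rwa [hl])⟩ ?_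
        obtain ⟨q, r', hq⟩ := ReplaceAt.exists_of_mem_vars hy g l
        rw [show g y = l from Function.update_self .. ] at hq
        obtain ⟨t₃, h₃⟩ := h.symm.exists_replace r'
        exact ⟨_, _, h₃.trans hq⟩
    exact this l ⟨[], l, .here _ _⟩

/-- Cut the reduction before each further `S`-step: it becomes a nonempty chain of steps of `→_S ∘
→*_P`, whose transitive closure is well-founded as well. -/
theorem RelTerminating.wellFounded {S P : Set (Eqn L V)} (h : RelTerminating S P) :
    WellFounded fun t s : L.Term V => ∃ w, Step S s w ∧ Steps (S ∪ P) w t := by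
  refine Subrelation.wf (r := Relation.TransGen fun t s : L.Term V =>
    ∃ w, Step S s w ∧ Steps P w t) ?_ h.transGen
  rintro t s ⟨w, hsw, hwt⟩
  induction hwt with
  | refl => exact .single ⟨w, hsw, .refl _⟩
  | @tail b c _ hbc ih =>
    obtain ⟨e, he | he, hbc⟩ := hbc
    · exact .head ⟨c, ⟨e, he, hbc⟩, .refl _⟩ ih
    · obtain ⟨b', ⟨w', h1, h2⟩, h3⟩ := Relation.TransGen.head'_iff.1 ih
      exact Relation.TransGen.head'_iff.2 ⟨b', ⟨w', h1, h2.tail ⟨e, he, hbc⟩⟩, h3⟩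

theorem reversible_symm (P : Set (Eqn L V)) : Reversible (symm P) :=
  fun _ _ h => h.par.symm.steps

/-- `n` is an `S`-normal form of `s` that is reached by a `T`-reduction which is empty or starts
with an `S`-step. -/
def IsHeadNormalForm (S T : Set (Eqn L V)) (s n : L.Term V) : Prop :=
  Normal S n ∧ HeadSteps S T s n

variable {S P T : Set (Eqn L V)}

theorem IsHeadNormalForm.of_headSteps (hST : S ⊆ T) {s t n : L.Term V} (h : HeadSteps S T s t)
    (hn : IsHeadNormalForm S T t n) : IsHeadNormalForm S T s n :=
  ⟨hn.1, h.trans hST hn.2⟩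

/-- Induction on `s`, and for fixed `s` on `t`. If `s` is `S`-reducible, closing the peak yields a
smaller left term. If only `t` is, the peak is taken at `t` with the roles exchanged. -/
theorem exists_headNormalForms_of_par (hST : S ⊆ T)
    (hwf : WellFounded fun t s : L.Term V => ∃ w, Step S s w ∧ Steps T w t)
    (hpeak : ∀ s t t' : L.Term V, Step S s t → Par (symm P) s t' →
      HeadParJoinable S T (symm P) t t') (s t : L.Term V) (h : Par (symm P) s t) :
    ∃ n m, IsHeadNormalForm S T s n ∧ IsHeadNormalForm S T t m ∧ Par (symm P) n m := by
  induction s using hwf.induction generalizing t with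
  | _ s ihs =>
    induction t using hwf.induction with
    | _ t iht =>
      by_cases hs : ∃ s', Step S s s'
      · obtain ⟨s', hs'⟩ := hs
        obtain ⟨u, v, hu, hv, huv⟩ := hpeak _ _ _ hs' h
        obtain ⟨n, m, hn, hm, hnm⟩ := ihs u ⟨s', hs', hu⟩ v huv
        exact ⟨n, m, hn.of_headSteps hST (Or.inr ⟨s', hs', hu⟩), hm.of_headSteps hST hv, hnm⟩
      have hns : Normal S s := fun s' hs' => hs ⟨s', hs'⟩
      by_cases ht : ∃ t', Step S t t'
      · obtain ⟨t', ht'⟩ := ht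
        obtain ⟨u, v, hu, hv, huv⟩ := hpeak _ _ _ ht' h.symm
        -- The head condition is decisive here: `s` is `S`-normal, so the reduction from it is
        -- empty, and the inner induction applies with the same `s`.
        obtain rfl : s = v := by
          rcases hv with hv | ⟨w, hw, -⟩
          · exact hv
          · exact absurd hw (hns w)
        obtain ⟨n, m, hn, hm, hnm⟩ := iht u ⟨t', ht', hu⟩ huv.symm
        exact ⟨n, m, hn, hm.of_headSteps hST (Or.inr ⟨t', ht', hu⟩), hnm⟩
      · exact ⟨s, t, ⟨hns, Or.inl rfl⟩, ⟨fun t' ht' => ht ⟨t', ht'⟩, Or.inl rfl⟩, h⟩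

/-- An abstract confluence criterion modulo the symmetric closure of `P`. -/
theorem confluent_of_peaks {P' : Set (Eqn L V)} (hP' : P' ⊆ symm P) (hrel : RelTerminating S P')
    (hSS : ∀ s t t' : L.Term V, Step S s t → Step S s t' →
      ParJoinable (S ∪ P') (symm P) t t')
    (hSP : ∀ s t t' : L.Term V, Step S s t → Par (symm P) s t' →
      HeadParJoinable S (S ∪ P') (symm P) t t') :
    Confluent (S ∪ symm P) := by
  have hST : S ⊆ S ∪ P' := Set.subset_union_left
  have hwf := hrel.wellFounded
  have hpar := exists_headNormalForms_of_par hST hwf hSP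
  have hrev : ∀ {s t : L.Term V}, Steps (symm P) s t → Steps (symm P) t s :=
    fun h => steps_symm (reversible_symm P) h
  -- Existence is the case of the empty parallel step.
  have hex : ∀ s, ∃ n, IsHeadNormalForm S (S ∪ P') s n := fun s =>
    let ⟨n, _, hn, _⟩ := hpar s s (.refl s)
    ⟨n, hn⟩
  -- Uniqueness of the head normal forms of `s` up to `P^±`-conversion.
  let U (s : L.Term V) : Prop := ∀ n m, IsHeadNormalForm S (S ∪ P') s n →
    IsHeadNormalForm S (S ∪ P') s m → Steps (symm P) n m
  have hstep : ∀ {s t : L.Term V}, Par (symm P) s t → U s → U t → ∀ n m,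
      IsHeadNormalForm S (S ∪ P') s n → IsHeadNormalForm S (S ∪ P') t m →
      Steps (symm P) n m := by
    intro s t h hs ht n m hn hm
    obtain ⟨n', m', hn', hm', hnm⟩ := hpar s t h
    exact ((hs n n' hn hn').trans hnm.steps).trans (ht m' m hm' hm)
  have hred : ∀ {s t : L.Term V}, Steps (S ∪ P') s t → (∀ u, Steps (S ∪ P') s u → U u) →
      ∀ n m, IsHeadNormalForm S (S ∪ P') s n → IsHeadNormalForm S (S ∪ P') t m →
      Steps (symm P) n m := by
    intro s t h hU
    induction h with
    | refl => exact hU s (.refl s)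
    | @tail b c hsb hbc ih =>
      intro n m hn hm
      obtain ⟨e, he | he, hbc'⟩ := hbc
      -- A head normal form of `c` is one of `b`, because `b → c` is an `S`-step.
      · exact ih n m hn (hm.of_headSteps hST (Or.inr ⟨c, ⟨e, he, hbc'⟩, .refl c⟩))
      · obtain ⟨k, hk⟩ := hex b
        exact (ih n k hn hk).trans (hstep (Step.par ⟨e, hP' he, hbc'⟩) (hU b hsb)
          (hU c (Steps.tail hsb ⟨e, Or.inr he, hbc'⟩)) k m hk hm)
  have hU : ∀ s, U s := by
    intro s
    induction s using hwf.induction with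
    | _ s ih =>
      rintro n m ⟨hn, hsn⟩ ⟨hm, hsm⟩
      rcases hsn with rfl | ⟨s₁, hs₁, h₁⟩
      · rcases hsm with rfl | ⟨w, hw, -⟩
        · exact .refl _
        · exact absurd hw (hn w)
      rcases hsm with rfl | ⟨s₂, hs₂, h₂⟩
      · exact absurd hs₁ (hm s₁)
      obtain ⟨u, v, hu, hv, huv⟩ := hSS s s₁ s₂ hs₁ hs₂
      obtain ⟨u', v', hu', hv', huv'⟩ := hpar u v huv
      obtain ⟨a, ha⟩ := hex s₁
      obtain ⟨b, hb⟩ := hex s₂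
      -- All `T`-reducts of `s₁` and of `s₂` lie below `s`, so the induction hypothesis provides
      -- uniqueness along the reductions from them. The conversion then runs `n ~ a ~ u' ~ v' ~ b ~
      -- m`.
      have r₁ := fun {t} (h : Steps (S ∪ P') s₁ t) =>
        hred h (fun w hw => ih w ⟨s₁, hs₁, hw⟩)
      have r₂ := fun {t} (h : Steps (S ∪ P') s₂ t) =>
        hred h (fun w hw => ih w ⟨s₂, hs₂, hw⟩)
      have e₁ := (hrev (r₁ h₁ a n ha ⟨hn, Or.inl rfl⟩)).trans (r₁ hu a u' ha hu')
      have e₂ := (hrev (r₂ hv b v' hb hv')).trans (r₂ h₂ b m hb ⟨hm, Or.inl rfl⟩)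
      exact (e₁.trans huv'.steps).trans e₂
  have hconv : ∀ {s t : L.Term V}, Steps (S ∪ symm P) s t → ∀ n m,
      IsHeadNormalForm S (S ∪ P') s n → IsHeadNormalForm S (S ∪ P') t m →
      Steps (symm P) n m := by
    intro s t h
    induction h with
    | refl => exact hU s
    | @tail b c _ hbc ih =>
      intro n m hn hm
      obtain ⟨e, he | he, hbc'⟩ := hbc
      · exact ih n m hn (hm.of_headSteps hST (Or.inr ⟨c, ⟨e, he, hbc'⟩, .refl c⟩))
      · obtain ⟨k, hk⟩ := hex b
        exact (ih n k hn hk).trans (hstep (Step.par ⟨e, he, hbc'⟩) (hU b) (hU c) k m hk hm)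
  intro s t t' ht ht'
  obtain ⟨a, ha⟩ := hex s
  obtain ⟨n, hn⟩ := hex t
  obtain ⟨m, hm⟩ := hex t'
  have hsub : S ∪ P' ⊆ S ∪ symm P := Set.union_subset_union_right _ hP'
  -- The head normal form `m` of `t'` is the common reduct: `t` first reaches its own head normal
  -- form `n`, and then `m` by `P^±`-steps.
  refine ⟨m, ?_, (hm.2.steps hST).mono hsub⟩
  refine ((hn.2.steps hST).mono hsub).trans (Steps.mono Set.subset_union_right ?_)
  exact (hrev (hconv ht a n ha hn)).trans (hconv ht' a m ha hm)

end Confluence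

/-! ### From successful checks to confluence -/

section Checks

variable {L : FirstOrder.Language.{u, v}} {V : Type w} {S P P' : Set (Eqn L V)}

theorem RewSeq.steps_of_subset {s t : L.Term V} {A : Set (Eqn L V)}
    (h : RewSeq (S ∪ symm P) s t A) (hA : ∀ e ∈ symm P, e ∈ A → e ∈ P') :
    Steps (S ∪ P') s t :=
  h.steps.mono fun _ he => he.1.imp id fun h => hA _ h he.2

theorem JoinCheck.parJoinable {s t : L.Term V} {A : Set (Eqn L V)} (h : JoinCheck S P s t A)
    (hA : ∀ e ∈ symm P, e ∈ A → e ∈ P') : ParJoinable (S ∪ P') (symm P) s t := by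
  obtain ⟨s', t', A₁, A₂, h₁, h₂, hpar, rfl⟩ := h
  exact ⟨s', t', h₁.steps_of_subset fun e he h => hA e he (Or.inl h),
    h₂.steps_of_subset fun e he h => hA e he (Or.inr h), hpar.symm⟩

/-- The tag enforces the head condition: with `true` nothing is done from `s`, and with `false` the
reduction from `s` begins with an `S`-step. The closing parallel step may use all of `P^±`, and its
rules need not belong to `P'`. -/
theorem Check.headParJoinable {b : Bool} {s t : L.Term V} {A : Set (Eqn L V)}
    (h : Check S P b s t A) (hA : ∀ e ∈ symm P, e ∈ A → e ∈ P') :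
    HeadParJoinable S (S ∪ P') (symm P) t s := by
  cases b with
  | true =>
    obtain ⟨t', h, hpar⟩ := h
    exact ⟨t', s, h.steps_of_subset hA, Or.inl rfl, hpar⟩
  | false =>
    obtain ⟨e, w, s', t', A₁, A₂, he, hw, h₁, h₂, hpar, rfl⟩ := h
    refine ⟨t', s', h₂.steps_of_subset fun e he h => hA e he (Or.inr (Or.inr h)),
      Or.inr ⟨w, ⟨e, he, hw⟩, ?_⟩, hpar⟩
    exact h₁.steps_of_subset fun e he h => hA e he (Or.inr (Or.inl h))

theorem HeadParJoinable.parJoinable {s t : L.Term V}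
    (h : HeadParJoinable S (S ∪ P') (symm P) t s) : ParJoinable (S ∪ P') (symm P) s t :=
  let ⟨u, v, h1, h2, h3⟩ := h
  ⟨v, u, h2.steps Set.subset_union_left, h1, h3.symm⟩

theorem Gathers.headParJoinable {amended : Bool} {N₁ : Eqn L V → NormPair L V}
    {X : Set (Bool × Eqn L V)} (hN : TakesNormalForms S (CP S (symm P)) N₁)
    (h : Gathers amended S P (U₁ S P N₁) X P') {a b : L.Term V}
    (hab : eqn a b ∈ CP S (symm P)) : HeadParJoinable S (S ∪ P') (symm P) a b := by
  classical
  obtain ⟨he, ha, hb⟩ := hN _ hab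
  obtain ⟨g, hga, hgb⟩ := instance_of_eqn_eq he Term.var
  rw [subst_var] at hga hgb
  suffices H : HeadParJoinable S (S ∪ P') (symm P) (N₁ (eqn a b)).a (N₁ (eqn a b)).b by
    have := H.subst g
    rwa [← hga, ← hgb] at this
  by_cases hf : Fails₁ P N₁ (eqn a b)
  · obtain ⟨W₁, W₂, h₁, -, hP'⟩ := h
    have hx : (decide (Normal S (N₁ (eqn a b)).b), eqn (N₁ (eqn a b)).b (N₁ (eqn a b)).aNF) ∈
        U₁ S P N₁ := ⟨_, hab, hf, by simp, rfl⟩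
    obtain ⟨s, t, hst, hc⟩ := h₁ _ hx
    -- The terms that were checked are only a variant of the pair; the joining reductions are
    -- carried over by the renaming.
    obtain ⟨k, hs, ht⟩ := instance_of_eqn_eq hst Term.var
    rw [subst_var] at hs ht
    have hst' : HeadParJoinable S (S ∪ P') (symm P) t s :=
      hc.headParJoinable fun e he h => hP' ▸ ⟨he, Or.inl ⟨_, hx, h⟩⟩
    obtain ⟨u, v, h1, h2, h3⟩ := hst'.subst k
    rw [← ht] at h1
    rw [← hs] at h2
    exact ⟨u, v, (ha.1.mono Set.subset_union_left).trans h1, h2, h3⟩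
  · exact ⟨_, _, ha.1.mono Set.subset_union_left, hb.1.headSteps Set.subset_union_left,
      not_not.1 hf⟩

/-- Both sides of an `S`-peak are already below its source, so no head condition is needed. This is
why the amended check is sound. -/
theorem Gathers.parJoinable {amended : Bool} {N₂ : Eqn L V → NormPair L V}
    {X : Set (Bool × Eqn L V)} (hN : TakesNormalForms S (CP S S) N₂)
    (h : Gathers amended S P X (U₂ S P N₂) P') {a b : L.Term V} (hab : eqn a b ∈ CP S S) :
    ParJoinable (S ∪ P') (symm P) a b := by
  obtain ⟨he, ha, hb⟩ := hN _ hab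
  obtain ⟨g, hga, hgb⟩ := instance_of_eqn_eq he Term.var
  rw [subst_var] at hga hgb
  suffices H : ParJoinable (S ∪ P') (symm P) (N₂ (eqn a b)).a (N₂ (eqn a b)).b by
    have := H.subst g
    rwa [← hga, ← hgb] at this
  have ha' := ha.1.mono (Set.subset_union_left (t := P'))
  have hb' := hb.1.mono (Set.subset_union_left (t := P'))
  by_cases hf : Fails₂ P N₂ (eqn a b)
  · obtain ⟨W₁, W₂, -, h₂, hP'⟩ := h
    have hx : (false, eqn (N₂ (eqn a b)).aNF (N₂ (eqn a b)).bNF) ∈ U₂ S P N₂ :=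
      ⟨_, hab, hf, rfl⟩
    obtain ⟨s, t, hst, hc⟩ := h₂ _ hx
    obtain ⟨k, hs, ht⟩ := instance_of_eqn_eq hst Term.var
    rw [subst_var] at hs ht
    have hst' : ParJoinable (S ∪ P') (symm P) s t := by
      rcases hc with hc | ⟨-, hc⟩
      · exact (hc.headParJoinable fun e he h => hP' ▸ ⟨he, Or.inr ⟨_, hx, h⟩⟩).parJoinable
      · exact hc.parJoinable fun e he h => hP' ▸ ⟨he, Or.inr ⟨_, hx, h⟩⟩
    obtain ⟨u, v, h1, h2, h3⟩ := hst'.subst k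
    rw [← hs] at h1
    rw [← ht] at h2
    exact ⟨u, v, ha'.trans h1, hb'.trans h2, h3⟩
  · exact ⟨_, _, ha', hb', (not_not.1 hf).symm⟩

/-- The criterion gives confluence of `S ∪ P^±`, which has the same many-step relation as `S ∪ P`
because `P` is reversible. -/
theorem Admissible.confluent [Infinite V] {amended : Bool} {Q : Set (Eqn L V)}
    {N₁ N₂ : Eqn L V → NormPair L V} (hQ : Admissible Q S P)
    (hN₁ : TakesNormalForms S (CP S (symm P)) N₁) (hN₂ : TakesNormalForms S (CP S S) N₂)
    (h : Gathers amended S P (U₁ S P N₁) (U₂ S P N₂) P') (hrel : RelTerminating S P') :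
    Confluent Q := by
  obtain ⟨⟨rfl, -, hrev⟩, hlin, hterm, hin⟩ := hQ
  have hP' : P' ⊆ symm P := by
    obtain ⟨_, _, -, -, rfl⟩ := h
    exact fun e he => he.1
  have hST : S ⊆ S ∪ P' := Set.subset_union_left
  have hconf : Confluent (S ∪ symm P) := confluent_of_peaks hP' hrel
    (fun _ _ _ => peak_parJoinable hST hterm.properRules fun _ _ => h.parJoinable hN₂)
    (fun _ _ _ => par_peak_headParJoinable hST hterm.properRules hlin hin
      fun _ _ => h.headParJoinable hN₁)
  have hto : ∀ {s t : L.Term V}, Steps (S ∪ P) s t → Steps (S ∪ symm P) s t := fun h =>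
    h.mono (Set.union_subset_union_right _ Set.subset_union_left)
  have hof : ∀ {s t : L.Term V}, Steps (S ∪ symm P) s t → Steps (S ∪ P) s t := by
    refine fun h => steps_of_derivable (fun e he => ?_) h
    rcases he with he | he
    · exact exists_derivable_of_mem (Or.inl he)
    · obtain ⟨l, r, rfl⟩ := exists_eqn e
      exact ⟨l, r, rfl,
        (steps_of_steps_symm hrev (steps_of_eqn_mem he)).mono Set.subset_union_right⟩
  intro s t t' h₁ h₂
  obtain ⟨w, hw₁, hw₂⟩ := hconf s t t' (hto h₁) (hto h₂)
  exact ⟨w, hof hw₁, hof hw₂⟩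

theorem Terminating.relTerminating_empty (h : Terminating S) : RelTerminating S ∅ := by
  refine Subrelation.wf ?_ h
  rintro t s ⟨w, hw, hwt⟩
  rcases Relation.ReflTransGen.cases_tail hwt with rfl | ⟨_, -, e, he, -⟩
  · exact hw
  · exact absurd he (Set.notMem_empty e)

/-- Success without failed pairs thereby becomes the case `P' = ∅` of the general criterion, where
relative termination is plain termination of `S`. -/
theorem gathers_empty (amended : Bool) : Gathers amended S P ∅ ∅ ∅ :=
  ⟨fun _ => ∅, fun _ => ∅, by simp, by simp, by simp⟩

end Checks

/-! ### The invariant of the runs -/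

section Runs

variable {L : FirstOrder.Language.{u, v}} {V : Type w}

/-- The two systems have the same many-step rewrite relation. -/
def SameSteps (Q R : Set (Eqn L V)) : Prop := ∀ s t, Steps Q s t ↔ Steps R s t

theorem SameSteps.union {Q R U : Set (Eqn L V)} (h : SameSteps Q R)
    (hU : ∀ e ∈ U, ∃ l r, e = eqn l r ∧ Steps Q l r) : SameSteps (Q ∪ U) R := by
  refine fun s t => Iff.trans ⟨fun hst => ?_, Steps.mono Set.subset_union_left⟩ (h s t)
  exact steps_of_derivable (fun e he => he.elim exists_derivable_of_mem (hU e)) hst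

theorem SameSteps.replace {Q R S P : Set (Eqn L V)} {l r r' : L.Term V} (h : SameSteps Q R)
    (hQ : S ∪ P ⊆ Q) (hd : Disjoint S P) (hP : Reversible P) (hl : eqn l r ∈ S)
    (hr : Conv P r r') : SameSteps ((Q \ {eqn l r}) ∪ {eqn l r'}) R := by
  have hrr' : Steps P r r' := steps_of_convs hP (.single hr)
  -- The removed rule lies in `S`, so `P` survives and can still convert between `r` and `r'`.
  have hPQ : P ⊆ Q \ {eqn l r} := fun e he =>
    ⟨hQ (Or.inr he), fun h => Set.disjoint_left.1 hd hl (h ▸ he)⟩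
  refine fun s t => Iff.trans ⟨fun hst => ?_, fun hst => ?_⟩ (h s t)
  · refine steps_of_derivable (fun e he => ?_) hst
    rcases he with he | rfl
    · exact exists_derivable_of_mem he.1
    · exact ⟨l, r', rfl, (steps_of_eqn_mem (hQ (Or.inl hl))).trans
        (hrr'.mono fun e he => (hPQ he).1)⟩
  · refine steps_of_derivable (fun e he => ?_) hst
    by_cases heq : e = eqn l r
    · exact ⟨l, r, heq, (steps_of_eqn_mem (Or.inr rfl)).trans
        ((steps_symm hP hrr').mono fun e he => Or.inl (hPQ he))⟩
    · exact exists_derivable_of_mem (Or.inl ⟨he, heq⟩)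

theorem SameSteps.confluent {Q R : Set (Eqn L V)} (h : SameSteps Q R) (hQ : Confluent Q) :
    Confluent R := by
  intro s t t' h₁ h₂
  obtain ⟨w, hw₁, hw₂⟩ := hQ s t t' ((h _ _).2 h₁) ((h _ _).2 h₂)
  exact ⟨w, (h _ _).1 hw₁, (h _ _).1 hw₂⟩

theorem CPin_subset_CP (A B : Set (Eqn L V)) : CPin A B ⊆ CP A B := Set.subset_union_right

/-- The rule `v → û` is derived by going from `v` back to the source of the critical peak, by
reversibility of `P`, and then down the `S`-side. Candidates from `U₂` are `P`-convertible by
requirement. -/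
theorem steps_of_candidate {S P : Set (Eqn L V)} {N₁ N₂ : Eqn L V → NormPair L V}
    (hP : Reversible P) (hN₁ : TakesNormalForms S (CP S (symm P)) N₁) {e : Eqn L V}
    (he : e ∈ Candidates P (U₁ S P N₁) (U₂ S P N₂)) :
    ∃ l r, e = eqn l r ∧ Steps (S ∪ P) l r := by
  rcases he with ⟨b, c, hc, -, -, rfl⟩ | ⟨b, l, r, -, hlr, rfl | rfl⟩
  · obtain ⟨hce, ha, -⟩ := hN₁ c hc
    obtain ⟨m, hm₁, hm₂⟩ := exists_peak_of_mem_CP (hce ▸ hc)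
    refine ⟨_, _, rfl, Steps.trans (t := m) ?_ (Steps.trans ?_ (ha.1.mono Set.subset_union_left))⟩
    · exact (steps_symm hP (steps_of_steps_symm hP hm₂.steps)).mono Set.subset_union_right
    · exact (hm₁.mono Set.subset_union_left).steps
  · exact ⟨l, r, rfl, (steps_of_convs hP hlr).mono Set.subset_union_right⟩
  · exact ⟨r, l, rfl, (steps_symm hP (steps_of_convs hP hlr)).mono Set.subset_union_right⟩

/-- The invariant of the runs on the input `R`. -/
def Invariant (R : Set (Eqn L V)) : State L V → Prop
  | .step1 Q => SameSteps Q R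
  | .step2 Q => SameSteps Q R
  | .step3 Q S P => SameSteps Q R ∧ Admissible Q S P
  | .step4 Q S P N₁ => SameSteps Q R ∧ Admissible Q S P ∧ TakesNormalForms S (CP S (symm P)) N₁
  | .step5 Q S P N₁ N₂ => SameSteps Q R ∧ Admissible Q S P ∧
      TakesNormalForms S (CP S (symm P)) N₁ ∧ TakesNormalForms S (CP S S) N₂
  | .step4a Q S P _ _ => SameSteps Q R ∧ S ∪ P ⊆ Q ∧ Disjoint S P ∧ Reversible P
  | .success => Confluent R
  | .failure => True

theorem Next.invariant [Infinite V] {amended : Bool} {R : Set (Eqn L V)} {x y : State L V}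
    (h : Next amended x y) (hx : Invariant R x) : Invariant R y := by
  cases h with
  | init => exact hx
  | partition Q S P h => exact ⟨hx, h⟩
  | noPartition => trivial
  | replaceInner Q S P l r r' hp hl hr hcp =>
    exact SameSteps.replace hx hp.1.subset hp.2.1 hp.2.2 hl hr
  | addInner Q S P a b b' hp hcp hb =>
    obtain ⟨rfl, -, hrev⟩ := hp
    refine SameSteps.union hx fun e he => ⟨a, b', he, ?_⟩
    -- The new rule is derived through the source `m` of the peak: from `a` back to `m` by `P`, then
    -- to `b` and `b'` by `S`.
    obtain ⟨m, hm₁, hm₂⟩ := exists_peak_of_mem_CP (CPin_subset_CP _ _ hcp)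
    refine Steps.trans (t := m) ?_ (Steps.trans ?_ (hb.1.mono Set.subset_union_left))
    · exact (steps_symm hrev (steps_of_steps_symm hrev hm₁.steps)).mono Set.subset_union_right
    · exact (hm₂.mono Set.subset_union_left).steps
  | normalize₁ Q S P N₁ hN => exact ⟨hx.1, hx.2, hN⟩
  | success₄ Q S P N₁ N₂ hN h₁ h₂ =>
    obtain ⟨hQR, hQ, hN₁⟩ := hx
    refine hQR.confluent (hQ.confluent hN₁ hN (amended := amended) ?_
      hQ.2.2.1.relTerminating_empty)
    rw [h₁, h₂]
    exact gathers_empty amended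
  | normalize₂ Q S P N₁ N₂ hN _ => exact ⟨hx.1, hx.2.1, hx.2.2, hN⟩
  | success₅ Q S P P' N₁ N₂ hP' ht =>
    obtain ⟨hQR, hQ, hN₁, hN₂⟩ := hx
    exact hQR.confluent (hQ.confluent hN₁ hN₂ hP' ht)
  | extend Q S P U' N₁ N₂ _ hU _ =>
    obtain ⟨hQR, ⟨⟨rfl, hd, hrev⟩, -⟩, hN₁, -⟩ := hx
    exact ⟨hQR.union fun e he => steps_of_candidate hrev hN₁ (hU he), Set.subset_union_left, hd,
      hrev⟩
  | skip => exact hx.1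
  | replaceBad Q S P N₁ N₂ l r r' hl hr _ =>
    obtain ⟨hQR, hsub, hd, hrev⟩ := hx
    exact hQR.replace hsub hd hrev hl hr

theorem ReturnsSuccess.confluent [Infinite V] {amended : Bool} {R : Set (Eqn L V)}
    (h : ReturnsSuccess amended R) : Confluent R := by
  have : ∀ x, Relation.ReflTransGen (Next amended) (State.step1 R) x → Invariant R x := by
    intro x hx
    induction hx with
    | refl => exact fun s t => Iff.rfl
    | tail _ h ih => exact h.invariant ih
  exact this _ h

end Runs

end Rewriting

/-- Soundness of the concrete reduction-preserving completion procedure, in its literal and in its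
amended version. -/
theorem corollary4p7 {L : FirstOrder.Language} {V : Type*} [Infinite V]
    (amended : Bool) (R : Set (Rewriting.Eqn L V)) (hR : Rewriting.IsTRS R)
    (hsuccess : Rewriting.ReturnsSuccess amended R) :
    Rewriting.Confluent R :=
  hsuccess.confluent
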